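/- Let $V$ be a finite-dimensional vector space over the finite field with $p$ elements, equipped with a nondegenerate Hermitian form (with respect to a nontrivial involution of the field), a nondegenerate alternating form, or a nondegenerate quadratic form, and let $\mathcal P$ be the polar space of all totally isotropic subspaces. Let $n$ be its rank, that is, the maximal dimension of a totally isotropic subspace, and let $X$ be the set of its generators, that is, of the totally isotropic $n$-dimensional subspaces. Let $e$ be the parameter of $\mathcal P$: $e=-\tfrac12,\tfrac12$ in the Hermitian case with $\dim V=2n,\,2n+1$; $e=0$ in the alternating case; $e=-1,0,1$ in the quadratic case with $\dim V=2n,\,2n+1,\,2n+2$, respectively. Write $\binom{m}{k}_p=\prod_{j=1}^{k}\frac{p^{m-j+1}-1}{p^j-1}$ for $m,k\ge 0$, and $\binom{m}{k}_p=0$ for $k<0$. For $i=0,\dots,n$ let $R_i=\{(U,W)\in X\times X:\dim(U\cap W)=n-i\}$, let $D_i$ be the adjacency matrix of $R_i$, and put $$P_i(k)=v_i\binom{n}{k}_p^{-1}\sum_{\ell=0}^{i}(-1)^\ell\binom{n-i}{k-\ell}_p\binom{i}{\ell}_p\,p^{\ell(\ell-i-e-1)},\qquad v_i=p^{\binom{i+1}{2}+ie}\binom{n}{i}_p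 .$$ Let $E_0,\dots,E_n$ be the basis of minimal idempotents of the complex span of $D_0,\dots,D_n$ (the Bose–Mesner algebra), ordered such that $D_i=\sum_{k=0}^n P_i(k)E_k$ for all $i$, and define the real numbers $Q_k(i)$ by $E_k=\frac1{|X|}\sum_{i=0}^nQ_k(i)D_i$; these $E_k$ and $Q_k(i)$ exist. Let $t$ be an integer with $1\le t\le n$ and let $Y\subseteq X$ be a $t$-Steiner system, that is, every totally isotropic $t$-dimensional subspace is contained in exactly one member of $Y$. Let $A_i=|(Y\times Y)\cap R_i|/|Y|$ be the inner distribution of $Y$ and $A'_k=\sum_{i=0}^nQ_k(i)A_i$ its dual distribution. Then $$A_{n-i}=\sum_{j=i}^{t-1}(-1)^{j-i}p^{\binom{j-i}{2}}\binom{j}{i}_p\binom{n}{j}_p\left(\prod_{\ell=j}^{t-1}\bigl(1+p^{\,n-\ell+e}\bigr)-1\right)\qquad\text{for all } i=0,1,\dots,n-1,$$ and $$A'_1=A'_2=\cdots=A'_t=0 .$$ -/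

import Mathlib

open Module Finset
open scoped BigOperators Classical

/-- The `q`-binomial coefficient `∏_{j=1}^k (q^(n-j+1) - 1) / (q^j - 1)`
(the product index is shifted by one; the value is `0` for `k > n` because of the factor `q^0 - 1`). -/
noncomputable def qBinom (q : ℝ) (n k : ℕ) : ℝ :=
  ∏ j ∈ range k, (q ^ (n - j) - 1) / (q ^ (j + 1) - 1)

/-- The nondegenerate forms that define the finite classical polar spaces: Hermitian forms
(with respect to a nontrivial involution of the field), alternating forms and quadratic forms.
A quadratic form `Q` is nondegenerate if no nonzero `x` with `Q x = 0` lies in the radical of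
its polar form (so parabolic quadrics in characteristic two are included). -/
inductive ClassicalForm (K V : Type*) [Field K] [AddCommGroup V] [Module K V] where
  | hermitian (σ : K →+* K) (σ_ne : σ ≠ RingHom.id K) (σ_invol : ∀ a, σ (σ a) = a)
      (B : V →ₛₗ[σ] V →ₗ[K] K) (herm : ∀ x y, B x y = σ (B y x))
      (nondeg : ∀ x, (∀ y, B x y = 0) → x = 0)
  | alternating (B : V →ₗ[K] V →ₗ[K] K) (alt : ∀ x, B x x = 0)
      (nondeg : ∀ x, (∀ y, B x y = 0) → x = 0)
  | quadratic (Q : QuadraticForm K V)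
      (nondeg : ∀ x, Q x = 0 → (∀ y, QuadraticMap.polar Q x y = 0) → x = 0)

namespace ClassicalForm

variable {K V : Type*} [Field K] [AddCommGroup V] [Module K V]

/-- Totally isotropic subspaces (the members of the polar space). -/
def IsTotallyIsotropic (F : ClassicalForm K V) (U : Submodule K V) : Prop :=
  match F with
  | hermitian _ _ _ B _ _ => ∀ u ∈ U, ∀ w ∈ U, B u w = 0
  | alternating B _ _ => ∀ u ∈ U, ∀ w ∈ U, B u w = 0
  | quadratic Q _ => ∀ u ∈ U, Q u = 0

/-- The rank of the polar space: the maximal dimension of a totally isotropic subspace. -/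
noncomputable def rank (F : ClassicalForm K V) : ℕ :=
  sSup {d | ∃ U : Submodule K V, F.IsTotallyIsotropic U ∧ finrank K U = d}

/-- The order `p` of the underlying field (as a real number). -/
noncomputable def fieldOrder (_F : ClassicalForm K V) : ℝ := (Nat.card K : ℝ)

/-- The parameter `e` of the polar space of rank `n`: in the Hermitian case it is `-1/2` or `1/2`
for `dim V = 2n` or `2n+1`; in the symplectic case it is `0`; in the quadratic case it is
`-1` (hyperbolic), `0` (parabolic) or `1` (elliptic) for `dim V = 2n`, `2n+1` or `2n+2`. -/
noncomputable def parameter (F : ClassicalForm K V) : ℝ :=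
  match F with
  | hermitian _ _ _ _ _ _ => (finrank K V : ℝ) - 2 * (F.rank : ℝ) - 1 / 2
  | alternating _ _ _ => 0
  | quadratic _ _ => (finrank K V : ℝ) - 2 * (F.rank : ℝ) - 1

/-- The set `X` of generators: totally isotropic subspaces of maximal dimension. -/
abbrev Generator (F : ClassicalForm K V) : Type _ :=
  {U : Submodule K V // F.IsTotallyIsotropic U ∧ finrank K U = F.rank}

noncomputable instance instFintypeGenerator [Finite K] [FiniteDimensional K V]
    (F : ClassicalForm K V) : Fintype F.Generator :=
  haveI : Finite V := Module.finite_of_finite K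
  haveI : Finite (Submodule K V) := Finite.of_injective (fun U => (U : Set V)) SetLike.coe_injective
  Fintype.ofFinite _

/-- The relation `R_i` on generators: `dim (U ∩ W) = n - i`. -/
def Rel (F : ClassicalForm K V) (i : ℕ) (U W : F.Generator) : Prop :=
  finrank K (U.1 ⊓ W.1 : Submodule K V) + i = F.rank

/-- A `t`-Steiner system: a set `Y` of generators such that every totally isotropic `t`-space
lies in exactly one member of `Y`. -/
def IsSteinerSystem (F : ClassicalForm K V) (t : ℕ) (Y : Finset F.Generator) : Prop :=
  ∀ T : Submodule K V, F.IsTotallyIsotropic T → finrank K T = t → ∃! U, U ∈ Y ∧ T ≤ U.1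

/-- The inner distribution `A_i = |(Y × Y) ∩ R_i| / |Y|`. -/
noncomputable def innerDistribution (F : ClassicalForm K V) (Y : Finset F.Generator) (i : ℕ) : ℝ :=
  (((Y ×ˢ Y).filter fun z => F.Rel i z.1 z.2).card : ℝ) / (Y.card : ℝ)

/-- The adjacency matrix `D_i` of `R_i`. -/
noncomputable def adjacency (F : ClassicalForm K V) (i : ℕ) : Matrix F.Generator F.Generator ℂ :=
  Matrix.of fun U W => if F.Rel i U W then 1 else 0

/-- The Bose-Mesner algebra, as the complex span of `D_0, …, D_n`. -/
def boseMesner (F : ClassicalForm K V) : Submodule ℂ (Matrix F.Generator F.Generator ℂ) :=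
  Submodule.span ℂ (Set.range fun i : Fin (F.rank + 1) => F.adjacency i)

/-- The valencies `v_i`. -/
noncomputable def valency (F : ClassicalForm K V) (i : ℕ) : ℝ :=
  F.fieldOrder ^ (((i + 1).choose 2 : ℝ) + i * F.parameter) * qBinom F.fieldOrder F.rank i

/-- The expression for the `P`-numbers `P_i(k)` that fixes the standard ordering of the
minimal idempotents. The summands with `ℓ > k` vanish in the usual convention
(`q`-binomial coefficients with a negative lower entry) and are left out. -/
noncomputable def pNumber (F : ClassicalForm K V) (i k : ℕ) : ℝ :=
  F.valency i * (qBinom F.fieldOrder F.rank k)⁻¹ *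
    ∑ l ∈ range (min i k + 1), (-1) ^ l * qBinom F.fieldOrder (F.rank - i) (k - l) *
      qBinom F.fieldOrder i l *
        F.fieldOrder ^ ((l : ℝ) * ((l : ℝ) - (i : ℝ) - F.parameter - 1))

/-- `E_0, …, E_n` is the basis of minimal idempotents of the Bose-Mesner algebra, in the
standard ordering: `D_i = ∑_k P_i(k) E_k` with the `P`-numbers above. -/
structure IsStandardIdempotents [Finite K] [FiniteDimensional K V] (F : ClassicalForm K V)
    (E : Fin (F.rank + 1) → Matrix F.Generator F.Generator ℂ) : Prop where
  linearIndependent : LinearIndependent ℂ E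
  span_eq : Submodule.span ℂ (Set.range E) = F.boseMesner
  idempotent : ∀ k, E k * E k = E k
  minimal : ∀ k, ∀ G ∈ F.boseMesner, G * G = G → E k * G = G → G = 0 ∨ G = E k
  ordering : ∀ i : Fin (F.rank + 1), F.adjacency i = ∑ k : Fin (F.rank + 1), (F.pNumber i k : ℂ) • E k

/-- `Q k i` are the `Q`-numbers `Q_k(i)` with respect to the standard ordering:
`E_k = |X|⁻¹ ∑_i Q_k(i) D_i`. -/
def IsQNumbers [Finite K] [FiniteDimensional K V] (F : ClassicalForm K V)
    (Q : Fin (F.rank + 1) → Fin (F.rank + 1) → ℝ) : Prop :=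
  ∃ E, F.IsStandardIdempotents E ∧
    ∀ k, E k = (Fintype.card F.Generator : ℂ)⁻¹ • ∑ i, (Q k i : ℂ) • F.adjacency i

/-- The dual distribution `A'_k = ∑_i Q_k(i) A_i`. -/
noncomputable def dualDistribution (F : ClassicalForm K V)
    (Q : Fin (F.rank + 1) → Fin (F.rank + 1) → ℝ) (Y : Finset F.Generator)
    (k : Fin (F.rank + 1)) : ℝ :=
  ∑ i, Q k i * F.innerDistribution Y i

end ClassicalForm

/-! Write `q` for the field order, `n` for the rank and `x = q ^ (e + 1)`. Everything rests on one
regularity property: for `j ≤ t`, the number of members of `Y` through a totally isotropic `j`-space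
depends only on `j`, namely `∏_{l=j}^{t-1} (1 + q^(n-1-l) x)` (`card_through`). It follows by double
counting `t`-spaces once the number of all generators through a `j`-space is known.

Inner distribution: counting `j`-spaces in the intersections of pairs from `Y` gives `∑_m binom(m,j)
A_{n-m} = binom(n,j) ∏_{l=j}^{t-1} (1 + q^(n-1-l) x)`. Two distinct members cannot share a
`t`-space, so besides the diagonal term `A_0 = 1` only `m < t` contributes, and `q`-binomial
inversion solves the triangular system.

Dual distribution: let `C_j` be the matrix whose `(U, W)` entry is the number of `j`-spaces in `U ∩
W`. By regularity, `C_j` maps the characteristic vectors of `Y` and of `X` to proportional vectors.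
The matrix `C_k` acts on `E_k` by a nonzero scalar (`intersectionEigen_ne_zero`), and `E_k` kills
the all-one vector for `k ≥ 1`. Hence `E_k` kills the characteristic vector of `Y` for `1 ≤ k ≤ t`,
and `A'_k` is a multiple of the corresponding quadratic form value.

The scheme itself is built from the dual polar graph `D_1`. A hyperplane of a generator lies in
exactly `x` further generators, proved for all three forms at once through `Model`. Hence `D_1` acts
on functions of the distance by `threeTerm` (`sum_neighbors`). The numbers `uNumber` are
eigenvectors of that recurrence with distinct eigenvalues `x [n-k] - [k]`. Rescaled, they give the
idempotents, and the relation between `D_1 D_i` and its neighbours yields `D_i E_k = P_i(k) E_k`. -/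

/-- The `q`-integer `(q^m - 1)/(q - 1)`. -/
noncomputable def qInt (q : ℝ) (m : ℕ) : ℝ := (q ^ m - 1) / (q - 1)

/-! ### Gaussian binomial coefficients: absorption, Pascal, inversion -/

section QBinom

variable {q : ℝ}

theorem pow_succ_sub_one_ne_zero (hq : 1 < q) (k : ℕ) : q ^ (k + 1) - 1 ≠ 0 :=
  (sub_pos.2 (one_lt_pow₀ hq (Nat.succ_ne_zero k))).ne'

theorem qInt_zero : qInt q 0 = 0 := by simp [qInt]

theorem qInt_ne_zero (hq : 1 < q) {m : ℕ} (hm : m ≠ 0) : qInt q m ≠ 0 := by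
  have := one_lt_pow₀ hq hm
  exact div_ne_zero (by linarith) (by linarith)

theorem qBinom_zero_right (m : ℕ) : qBinom q m 0 = 1 := by simp [qBinom]

/-- The ratio of consecutive coefficients with `q^(m-k) - 1` multiplied by `q^k`. This removes the
truncated exponent, so no comparison of `k` and `m` is needed later. -/
theorem qBinom_succ_mul (hq : 1 < q) (m k : ℕ) :
    (q ^ (k + 1) - 1) * q ^ k * qBinom q m (k + 1) = (q ^ m - q ^ k) * qBinom q m k := by
  have h1 : q ^ (k + 1) - 1 ≠ 0 :=
      pow_succ_sub_one_ne_zero hq _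
  rw [qBinom, prod_range_succ, ← qBinom]
  rcases le_or_gt k m with h | h
  · have h2 : q ^ m = q ^ (m - k) * q ^ k := by rw [← pow_add, Nat.sub_add_cancel h]
    rw [h2]
    field_simp
  · have : qBinom q m k = 0 := by
      rw [qBinom]
      exact prod_eq_zero (mem_range.2 h) (by simp)
    simp [this]

theorem qBinom_eq_zero_of_lt {m k : ℕ} (h : m < k) : qBinom q m k = 0 := by
  rw [qBinom]
  exact prod_eq_zero (mem_range.2 h) (by simp)

theorem qBinom_pos (hq : 1 < q) {m k : ℕ} (h : k ≤ m) : 0 < qBinom q m k := by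
  refine prod_pos fun j hj => div_pos ?_ ?_
  · have := one_lt_pow₀ hq (show m - j ≠ 0 by have := mem_range.1 hj; omega)
    linarith
  · exact sub_pos.2 (one_lt_pow₀ hq (Nat.succ_ne_zero j))

theorem qBinom_one_right (m : ℕ) : qBinom q m 1 = qInt q m := by simp [qBinom, qInt]

theorem qBinom_zero_left (k : ℕ) : qBinom q 0 k = if k = 0 then 1 else 0 := by
  rcases k with _ | k
  · simp [qBinom]
  · rw [qBinom_eq_zero_of_lt (Nat.succ_pos k), if_neg (Nat.succ_ne_zero k)]

/-- The absorption identity `[k] binom(m,k) = [m] binom(m-1,k-1)`. -/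
theorem qBinom_absorb (hq : 1 < q) (m k : ℕ) :
    (q ^ (k + 1) - 1) * qBinom q (m + 1) (k + 1) = (q ^ (m + 1) - 1) * qBinom q m k := by
  induction k with
  | zero =>
    have : q - 1 ≠ 0 := by linarith
    rw [qBinom_one_right, qBinom_zero_right, qInt]
    simp only [zero_add, pow_one]
    field_simp
  | succ k ih =>
    have h1 := qBinom_succ_mul hq (m + 1) (k + 1)
    have h2 := qBinom_succ_mul hq m k
    have h3 : (q ^ (k + 1) - 1) ≠ 0 :=
      pow_succ_sub_one_ne_zero hq _
    have h4 : q ^ (k + 1) ≠ 0 := by positivity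
    refine mul_left_cancel₀ (mul_ne_zero h3 h4) ?_
    calc _ = (q ^ (k + 1) - 1) * ((q ^ (k + 1 + 1) - 1) * q ^ (k + 1) *
          qBinom q (m + 1) (k + 1 + 1)) := by ring
      _ = _ := by
        rw [h1]
        linear_combination (q ^ (m + 1) - q ^ (k + 1)) * ih - q * (q ^ (m + 1) - 1) * h2

theorem qBinom_pascal (hq : 1 < q) (m k : ℕ) :
    qBinom q (m + 1) (k + 1) = q ^ (k + 1) * qBinom q m (k + 1) + qBinom q m k := by
  have h1 := qBinom_absorb hq m k
  have h2 := qBinom_succ_mul hq m k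
  have h3 : (q ^ (k + 1) - 1) ≠ 0 :=
      pow_succ_sub_one_ne_zero hq _
  refine mul_left_cancel₀ h3 ?_
  linear_combination h1 - q * h2

theorem qBinom_self (hq : 1 < q) (m : ℕ) : qBinom q m m = 1 := by
  induction m with
  | zero => simp [qBinom]
  | succ m ih => rw [qBinom_pascal hq, ih, qBinom_eq_zero_of_lt (Nat.lt_succ_self m)]; ring

theorem qBinom_succ_self (hq : 1 < q) (m : ℕ) : qBinom q (m + 1) m = qInt q (m + 1) := by
  induction m with
  | zero =>
    have : q - 1 ≠ 0 := by linarith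
    simp [qBinom, qInt, this]
  | succ m ih =>
    rw [qBinom_pascal hq, ih, qBinom_self hq, qInt, qInt]
    have : q - 1 ≠ 0 := by linarith
    field_simp
    ring

theorem qBinom_mul_qBinom (hq : 1 < q) (r s i : ℕ) :
    qBinom q (i + s) i * qBinom q (i + r) (i + s) = qBinom q (i + r) i * qBinom q r s := by
  induction i generalizing r s with
  | zero => simp [qBinom_zero_right]
  | succ i ih =>
    have h1 := qBinom_absorb hq (i + s) i
    have h2 := qBinom_absorb hq (i + r) (i + s)
    have h3 := qBinom_absorb hq (i + r) i
    have e1 : i + 1 + s = i + s + 1 := by ring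
    have e2 : i + 1 + r = i + r + 1 := by ring
    rw [e1, e2]
    have n1 : q ^ (i + 1) - 1 ≠ 0 :=
      pow_succ_sub_one_ne_zero hq _
    have n2 : q ^ (i + s + 1) - 1 ≠ 0 :=
      pow_succ_sub_one_ne_zero hq _
    refine mul_left_cancel₀ (mul_ne_zero n1 n2) ?_
    have := ih r s
    linear_combination (q ^ (i + s + 1) - 1) * qBinom q (i + r + 1) (i + s + 1) * h1 +
      (q ^ (i + s + 1) - 1) * qBinom q (i + s) i * h2 +
      (q ^ (i + s + 1) - 1) * (q ^ (i + r + 1) - 1) * this -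
      (q ^ (i + s + 1) - 1) * qBinom q r s * h3

theorem sum_alternating_qBinom (hq : 1 < q) (r : ℕ) :
    ∑ s ∈ range (r + 1), (-1 : ℝ) ^ s * q ^ (s.choose 2) * qBinom q r s =
      if r = 0 then 1 else 0 := by
  rcases r with _ | r
  · simp [qBinom]
  · rw [if_neg (Nat.succ_ne_zero r)]
    -- Pascal's rule makes the sum telescope: every partial sum has a closed form with factor
    -- `binom(r, N)`, which vanishes at `N = r + 1`.
    have key : ∀ N, ∑ s ∈ range (N + 1), (-1 : ℝ) ^ s * q ^ (s.choose 2) * qBinom q (r + 1) s =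
        (-1) ^ N * q ^ ((N + 1).choose 2) * qBinom q r N := by
      intro N
      induction N with
      | zero => simp [qBinom]
      | succ N ih =>
        rw [sum_range_succ, ih, qBinom_pascal hq, Nat.choose_succ_succ' (N + 1) 1, pow_add]
        simp only [Nat.choose_one_right]
        ring
    rw [key, qBinom_eq_zero_of_lt (Nat.lt_succ_self r), mul_zero]

theorem sum_qBinom_inversion (hq : 1 < q) {i m t : ℕ} (hm : m < t) :
    ∑ j ∈ Ico i t, (-1 : ℝ) ^ (j - i) * q ^ ((j - i).choose 2) * qBinom q j i * qBinom q m j =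
      if m = i then 1 else 0 := by
  rcases lt_or_ge m i with h | h
  · rw [if_neg h.ne]
    refine sum_eq_zero fun j hj => ?_
    rw [qBinom_eq_zero_of_lt (lt_of_lt_of_le h (mem_Ico.1 hj).1), mul_zero]
  · obtain ⟨r, rfl⟩ := Nat.exists_eq_add_of_le h
    rw [sum_Ico_eq_sum_range]
    have hsub : range (r + 1) ⊆ range (t - i) := by
      intro x hx
      rw [mem_range] at *
      omega
    rw [← sum_subset hsub]
    · have : ∀ s ∈ range (r + 1), (-1 : ℝ) ^ (i + s - i) * q ^ ((i + s - i).choose 2) *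
          qBinom q (i + s) i * qBinom q (i + r) (i + s) =
          qBinom q (i + r) i * ((-1 : ℝ) ^ s * q ^ (s.choose 2) * qBinom q r s) := by
        intro s _
        rw [Nat.add_sub_cancel_left]
        linear_combination (-1 : ℝ) ^ s * q ^ (s.choose 2) * qBinom_mul_qBinom hq r s i
      rw [sum_congr rfl this, ← mul_sum, sum_alternating_qBinom hq]
      by_cases hr : r = 0
      · subst hr; simp [qBinom_self hq]
      · simp [hr]
    · intro s _ hs
      rw [qBinom_eq_zero_of_lt (q := q) (m := i + r), mul_zero]
      rw [mem_range] at hs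
      omega

/-- The matrix `binom(m, j)` is unitriangular, so an identity linear in a function on `{0, …, N}`
need only be checked on the functions `binom(·, j)`. -/
theorem exists_qBinom_expansion (hq : 1 < q) (f : ℕ → ℝ) (N : ℕ) :
    ∃ c : ℕ → ℝ, ∀ m ≤ N, f m = ∑ j ∈ range (N + 1), c j * qBinom q m j := by
  induction N with
  | zero => exact ⟨fun _ => f 0, fun m hm => by simp [Nat.le_zero.1 hm, qBinom]⟩
  | succ N ih =>
    obtain ⟨c, hc⟩ := ih
    refine ⟨fun j => if j = N + 1 then f (N + 1) - ∑ j ∈ range (N + 1), c j * qBinom q (N + 1) j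
      else c j, fun m hm => ?_⟩
    rw [sum_range_succ]
    have : ∀ j ∈ range (N + 1), (if j = N + 1 then f (N + 1) -
        ∑ j ∈ range (N + 1), c j * qBinom q (N + 1) j else c j) * qBinom q m j =
        c j * qBinom q m j := by
      intro j hj
      rw [if_neg (mem_range.1 hj).ne]
    simp only [sum_congr rfl this, if_true]
    rcases Nat.lt_or_ge m (N + 1) with h | h
    · rw [qBinom_eq_zero_of_lt h, hc m (by omega)]; ring
    · obtain rfl : m = N + 1 := le_antisymm hm h
      rw [qBinom_self hq]; ring

end QBinom

/-! ### The three-term recurrence and its eigenvectors -/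

/-- The action of the adjacency matrix of the dual polar graph of rank `n` on functions of the
distance, where `x = q ^ (e + 1)`. -/
noncomputable def threeTerm (q x : ℝ) (n : ℕ) (f : ℕ → ℝ) (i : ℕ) : ℝ :=
  qInt q i * f (i - 1) + qInt q i * (x - 1) * f i + q ^ i * x * qInt q (n - i) * f (i + 1)

/-- The eigenvalues of the dual polar graph. -/
noncomputable def eigen (q x : ℝ) (n k : ℕ) : ℝ := x * qInt q (n - k) - qInt q k

/-- The unnormalised dual eigenvectors `∑_l (-1)^l binom(n-i,k-l) binom(i,l) q^(l(l-i)) x^(-l)`. -/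
noncomputable def uNumber (q x : ℝ) (n k i : ℕ) : ℝ :=
  ∑ l ∈ range (k + 1), (-1) ^ l * qBinom q (n - i) (k - l) * qBinom q i l *
    (q ^ (l * l) / q ^ (l * i)) * (x ^ l)⁻¹

section Recurrence

variable {q x : ℝ}

/-- In the basis `binom(n-i, j)` the recurrence is bidiagonal. This is the algebraic counterpart of
the geometric count `sum_neighbors_qBinom`. -/
theorem threeTerm_qBinom (hq : 1 < q) {n i j : ℕ} (hi : i ≤ n) (hj : j ≤ n) :
    threeTerm q x n (fun i => qBinom q (n - i) j) i =
      eigen q x n j * qBinom q (n - i) j +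
        (if j = 0 then 0 else qInt q (n + 1 - j) * qBinom q (n - i) (j - 1)) := by
  have h0 : q - 1 ≠ 0 := by linarith
  obtain ⟨m, rfl⟩ := Nat.exists_eq_add_of_le hi
  rcases j with _ | j
  · simp only [threeTerm, eigen, qBinom_zero_right, qInt, if_pos, Nat.add_sub_cancel_left,
      Nat.sub_zero, pow_add, pow_zero]
    field_simp
    ring
  · obtain ⟨d, hd⟩ := Nat.exists_eq_add_of_le hj
    have e1 : q ^ i * q ^ m = q ^ d * q ^ j * q := by
      rw [← pow_add, ← pow_add, ← pow_succ, hd]; congr 1; omega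
    have e2 : i + m - (j + 1) = d := by omega
    have e3 : i + m + 1 - (j + 1) = d + 1 := by omega
    have e4 : i + m - i = m := by omega
    have hr := qBinom_succ_mul hq m j
    have hj0 : q ^ j ≠ 0 := by positivity
    -- The factor `[i]` vanishes exactly where `i - 1` truncates; likewise `[m]` below covers the
    -- boundary `i = n`.
    have hA : qInt q i * qBinom q (i + m - (i - 1)) (j + 1) =
        qInt q i * (q ^ (j + 1) * qBinom q m (j + 1) + qBinom q m j) := by
      rcases i with _ | i
      · simp [qInt_zero]
      · rw [show i + 1 + m - (i + 1 - 1) = m + 1 by omega, qBinom_pascal hq]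
    have hB : qInt q m * qBinom q (i + m - (i + 1)) (j + 1) * q ^ (j + 1) =
        qInt q m * (qBinom q m (j + 1) ) - qInt q (j + 1) * qBinom q m (j + 1) := by
      rcases m with _ | m
      · simp [qInt_zero, qBinom_zero_left]
      · rw [show i + (m + 1) - (i + 1) = m by omega]
        have p := qBinom_pascal hq m j
        have a := qBinom_absorb hq m j
        simp only [qInt]
        field_simp
        linear_combination (1 - q ^ (m + 1)) * p + a
    rw [if_neg (Nat.succ_ne_zero j), threeTerm, eigen, e2, e3, e4, Nat.add_sub_cancel, hA]
    have hj1 : q ^ (j + 1) ≠ 0 := by positivity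
    have hB' : qInt q m * qBinom q (i + m - (i + 1)) (j + 1) =
        (qInt q m * (qBinom q m (j + 1) ) - qInt q (j + 1) * qBinom q m (j + 1)) / q ^ (j + 1) := by
      rw [← hB]; field_simp
    rw [mul_assoc _ (qInt q m), hB']
    simp only [qInt, pow_succ]
    rw [pow_succ] at hr
    generalize q ^ i = qi at *
    generalize q ^ m = qm at *
    generalize q ^ d = qd at *
    generalize q ^ j = qj at *
    field_simp
    linear_combination x * qBinom q m (j + 1) * e1 + q * qi * hr + q * qBinom q m j * e1

theorem qBinom_pred (hq : 1 < q) (m l : ℕ) :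
    q ^ l * (q ^ m - 1) * qBinom q (m - 1) l = (q ^ m - q ^ l) * qBinom q m l := by
  rcases m with _ | m
  · rcases l with _ | l <;> simp [qBinom_zero_left]
  · rw [Nat.add_sub_cancel, ← qBinom_succ_mul hq]
    linear_combination -q ^ l * qBinom_absorb hq m l

theorem qBinom_absorb_pred (hq : 1 < q) (m k : ℕ) :
    (q ^ m - 1) * qBinom q (m - 1) k = (q ^ (k + 1) - 1) * qBinom q m (k + 1) := by
  rcases m with _ | m
  · simp [qBinom_zero_left]
  · rw [Nat.add_sub_cancel, qBinom_absorb hq]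

/-- The coefficient of `x^(-l)` in `uNumber`. -/
noncomputable def uCoeff (q : ℝ) (n k i l : ℕ) : ℝ :=
  (-1) ^ l * qBinom q (n - i) (k - l) * qBinom q i l * (q ^ (l * l) / q ^ (l * i))

/-- This is the part of `threeTerm - eigen` without an explicit factor `x`, at `x^(-l)`. In the
factored form its vanishing at `l = k` is visible. -/
theorem uCoeff_pred (hq : 1 < q) {n k i l : ℕ} (hi : i ≤ n) (hl : l ≤ k) :
    qInt q i * uCoeff q n k (i - 1) l + (qInt q k - qInt q i) * uCoeff q n k i l =
      (-1) ^ l * (q ^ (l * l) / q ^ (l * i)) / (q - 1) * qBinom q i l *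
        ((q ^ i - q ^ l) * qBinom q (n - i + 1) (k - l) +
          (q ^ k - q ^ i) * qBinom q (n - i) (k - l)) := by
  have h0 : q - 1 ≠ 0 := by linarith
  have hql : q ^ l ≠ 0 := by positivity
  rcases i with _ | i
  · rcases l with _ | l
    · simp [uCoeff, qInt, qBinom_zero_right]
      field_simp
    · simp [uCoeff, qBinom_zero_left]
  · have h := qBinom_pred hq (i + 1) l
    rw [Nat.add_sub_cancel] at h
    have e : n - i = n - (i + 1) + 1 := by omega
    simp only [uCoeff, qInt, Nat.add_sub_cancel, e, Nat.mul_succ, pow_add q (l * i) l]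
    have : q ^ (l * i) ≠ 0 := by positivity
    field_simp
    linear_combination qBinom q (n - (i + 1) + 1) (k - l) * h

theorem uCoeff_zero_succ (hq : 1 < q) {n k i : ℕ} (hi : i ≤ n) (hk : k ≤ n) :
    (qInt q i - qInt q (n - k)) * uCoeff q n k i 0 +
      q ^ i * qInt q (n - i) * uCoeff q n k (i + 1) 0 = 0 := by
  have h0 : q - 1 ≠ 0 := by linarith
  have hqk : q ^ k ≠ 0 := by positivity
  have h := qBinom_pred hq (n - i) k
  have e : q ^ i * q ^ (n - i) = q ^ (n - k) * q ^ k := by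
    rw [← pow_add, ← pow_add]; congr 1; omega
  have e2 : n - (i + 1) = n - i - 1 := by omega
  simp only [uCoeff, qInt, e2, qBinom_zero_right, Nat.sub_zero, pow_zero, zero_mul]
  field_simp
  refine mul_left_cancel₀ hqk ?_
  linear_combination q ^ i * h + qBinom q (n - i) k * e

theorem uCoeff_succ (hq : 1 < q) {n k i l : ℕ} (hi : i ≤ n) (hk : k ≤ n) (hl : l < k) :
    qInt q i * uCoeff q n k (i - 1) l + (qInt q k - qInt q i) * uCoeff q n k i l +
      ((qInt q i - qInt q (n - k)) * uCoeff q n k i (l + 1) +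
        q ^ i * qInt q (n - i) * uCoeff q n k (i + 1) (l + 1)) = 0 := by
  rw [uCoeff_pred hq hi hl.le]
  obtain ⟨r, rfl⟩ := Nat.exists_eq_add_of_lt hl
  obtain ⟨a, rfl⟩ := Nat.exists_eq_add_of_le hi
  have h0 : q - 1 ≠ 0 := by linarith
  have s1 : i + a - i = a := by omega
  have s2 : l + r + 1 - l = r + 1 := by omega
  have s3 : i + a - (i + 1) = a - 1 := by omega
  have s4 : l + r + 1 - (l + 1) = r := by omega
  have e : q ^ (i + a - (l + r + 1)) * (q ^ l * q ^ r * q) = q ^ i * q ^ a := by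
    rw [← pow_add, ← pow_add, ← pow_succ, ← pow_add]; congr 1; omega
  have hB := qBinom_succ_mul hq a r
  have hL := qBinom_succ_mul hq i l
  have hA := qBinom_absorb_pred hq a r
  simp only [uCoeff, qInt, s1, s2, s3, s4, qBinom_pascal hq]
  have p1 : q ^ ((l + 1) * (l + 1)) = q ^ (l * l) * (q ^ l * q ^ l * q) := by
    rw [← pow_add, ← pow_succ, ← pow_add]; congr 1; ring
  have p2 : q ^ ((l + 1) * i) = q ^ (l * i) * q ^ i := by rw [← pow_add]; congr 1; ring
  have p3 : q ^ ((l + 1) * (i + 1)) = q ^ (l * i) * q ^ i * (q ^ l * q) := by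
    rw [← pow_succ, ← pow_add, ← pow_add]; congr 1; ring
  have p4 : q ^ (l + r + 1) = q ^ l * q ^ r * q := by rw [pow_succ, pow_add]
  rw [p1, p2, p3, p4]
  have t1 : q ^ l ≠ 0 := by positivity
  have t2 : q ^ r ≠ 0 := by positivity
  have t3 : q ^ i ≠ 0 := by positivity
  have t4 : q ^ (l * i) ≠ 0 := by positivity
  have t5 : q ≠ 0 := by positivity
  simp only [pow_succ] at hB hL hA ⊢
  generalize q ^ (i + a - (l + r + 1)) = w at *
  generalize q ^ (l * i) = z at *
  generalize q ^ (l * l) = z' at *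
  generalize q ^ l = ql at *
  generalize q ^ r = qr at *
  generalize q ^ i = qi at *
  generalize q ^ a = qa at *
  generalize qBinom q a (r + 1) = B at *
  generalize qBinom q a r = B' at *
  generalize qBinom q i (l + 1) = L' at *
  generalize qBinom q i l = L at *
  generalize qBinom q (a - 1) r = C at *
  field_simp
  refine mul_left_cancel₀ t2 ?_
  linear_combination ((-1) ^ l * z') * (-ql * qi * (q * ql * L' + L) * qr * hA -
    (qi * (q * qr - 1) * B + qi * B') * qr * hL - ql * L' * qi * hB + ql * L' * B' * e)

/-- Compare powers of `x`. The difference of the two sides splits as `α + x β`. The top coefficient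
of `α` and the constant coefficient of `β` vanish, and by `uCoeff_succ` the coefficient of `α` at
`x^(-l)` cancels that of `β` at `x^(-l-1)`. -/
theorem threeTerm_uNumber (hq : 1 < q) (hx : 0 < x) {n k i : ℕ} (hi : i ≤ n) (hk : k ≤ n) :
    threeTerm q x n (uNumber q x n k) i = eigen q x n k * uNumber q x n k i := by
  have hx0 := hx.ne'
  have hU : ∀ i, uNumber q x n k i = ∑ l ∈ range (k + 1), uCoeff q n k i l * (x ^ l)⁻¹ :=
    fun _ => rfl
  have hα : ∑ l ∈ range (k + 1), (qInt q i * uCoeff q n k (i - 1) l +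
      (qInt q k - qInt q i) * uCoeff q n k i l) * (x ^ l)⁻¹ =
      ∑ l ∈ range k, (qInt q i * uCoeff q n k (i - 1) l +
      (qInt q k - qInt q i) * uCoeff q n k i l) * (x ^ l)⁻¹ := by
    rw [sum_range_succ, uCoeff_pred hq hi le_rfl, Nat.sub_self, qBinom_zero_right,
      qBinom_zero_right]
    ring
  have hβ : x * ∑ l ∈ range (k + 1), ((qInt q i - qInt q (n - k)) * uCoeff q n k i l +
        q ^ i * qInt q (n - i) * uCoeff q n k (i + 1) l) * (x ^ l)⁻¹ =
      ∑ l ∈ range k, ((qInt q i - qInt q (n - k)) * uCoeff q n k i (l + 1) +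
        q ^ i * qInt q (n - i) * uCoeff q n k (i + 1) (l + 1)) * (x ^ l)⁻¹ := by
    rw [sum_range_succ', uCoeff_zero_succ hq hi hk, zero_mul, add_zero, mul_sum]
    refine sum_congr rfl fun l _ => ?_
    rw [pow_succ]
    field_simp
  have hs : threeTerm q x n (uNumber q x n k) i - eigen q x n k * uNumber q x n k i =
      ∑ l ∈ range (k + 1), (qInt q i * uCoeff q n k (i - 1) l +
      (qInt q k - qInt q i) * uCoeff q n k i l) * (x ^ l)⁻¹ +
      x * ∑ l ∈ range (k + 1), ((qInt q i - qInt q (n - k)) * uCoeff q n k i l +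
        q ^ i * qInt q (n - i) * uCoeff q n k (i + 1) l) * (x ^ l)⁻¹ := by
    simp only [threeTerm, eigen, hU, mul_sum, ← sum_add_distrib, ← sum_sub_distrib]
    exact sum_congr rfl fun l _ => by ring
  rw [← sub_eq_zero, hs, hα, hβ, ← sum_add_distrib]
  refine sum_eq_zero fun l hl => ?_
  rw [← add_mul, uCoeff_succ hq hi hk (mem_range.1 hl), zero_mul]

end Recurrence

/-! ### Counting subspaces over a finite field -/

section SubspaceCount

variable {K V : Type*} [Field K] [Finite K] [AddCommGroup V] [Module K V] [FiniteDimensional K V]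

theorem one_lt_card_field (K : Type*) [Field K] [Finite K] : (1 : ℝ) < (Nat.card K : ℝ) := by
  exact_mod_cast Finite.one_lt_card (α := K)

noncomputable instance instFintypeSubmoduleFiniteField : Fintype (Submodule K V) :=
  haveI : Finite V := Module.finite_of_finite K
  haveI : Finite (Submodule K V) := Finite.of_injective (fun U => (U : Set V)) SetLike.coe_injective
  Fintype.ofFinite _

/-- Independent families in a subspace of the right dimension are the independent families that
span it. -/
noncomputable def linearIndependentFiberEquiv {j : ℕ} (S : Submodule K V) (hS : finrank K S = j) :
    {s : {s : Fin j → V // LinearIndependent K s} // Submodule.span K (Set.range s.1) = S} ≃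
      {s : Fin j → S // LinearIndependent K s} where
  toFun s := ⟨fun i => ⟨s.1.1 i, s.2.le (Submodule.subset_span (Set.mem_range_self i))⟩,
    LinearIndependent.of_comp S.subtype s.1.2⟩
  invFun s := ⟨⟨fun i => (s.1 i : V), s.2.map' S.subtype S.ker_subtype⟩, by
    have h := s.2.span_eq_top_of_card_eq_finrank' (by simp [hS])
    have h2 : Set.range (fun i => (s.1 i : V)) = S.subtype '' Set.range s.1 := by
      rw [← Set.range_comp]; rfl
    rw [h2, Submodule.span_image, h, Submodule.map_top, Submodule.range_subtype]⟩
  left_inv s := rfl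
  right_inv s := rfl

theorem natCast_prod_pow_sub {q : ℕ} (hq : 1 < q) {m j : ℕ} (hj : j ≤ m) :
    ((∏ i : Fin j, (q ^ m - q ^ (i : ℕ)) : ℕ) : ℝ) = ∏ i ∈ range j, ((q : ℝ) ^ m - (q : ℝ) ^ i) := by
  rw [Nat.cast_prod, ← Fin.prod_univ_eq_prod_range (fun i => (q : ℝ) ^ m - (q : ℝ) ^ i)]
  refine prod_congr rfl fun i _ => ?_
  rw [Nat.cast_sub (Nat.pow_le_pow_right hq.le (by omega))]
  push_cast
  rfl

theorem qBinom_mul_prod {q : ℝ} (hq : 1 < q) (m j : ℕ) :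
    qBinom q m j * ∏ i ∈ range j, (q ^ j - q ^ i) = ∏ i ∈ range j, (q ^ m - q ^ i) := by
  rcases lt_or_ge m j with h | h
  · rw [qBinom_eq_zero_of_lt h, zero_mul]
    exact (prod_eq_zero (mem_range.2 h) (sub_self _)).symm
  rw [qBinom, prod_div_distrib, ← prod_range_reflect (fun i => q ^ (i + 1) - 1), ← prod_div_distrib,
    ← prod_mul_distrib]
  refine prod_congr rfl fun i hi => ?_
  have hi := mem_range.1 hi
  have e1 : q ^ m = q ^ (m - i) * q ^ i := by rw [← pow_add]; congr 1; omega
  have e2 : q ^ j = q ^ (j - 1 - i + 1) * q ^ i := by rw [← pow_add]; congr 1; omega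
  have := pow_succ_sub_one_ne_zero hq (j - 1 - i)
  rw [e1, e2]
  field_simp

/-- Sort the linearly independent `j`-tuples by their span: each `j`-space receives equally many,
namely its ordered bases. -/
theorem card_subspaces (K V : Type*) [Field K] [Finite K] [AddCommGroup V] [Module K V]
    [FiniteDimensional K V] (j : ℕ) :
    (Nat.card {S : Submodule K V // finrank K S = j} : ℝ) =
      qBinom (Nat.card K) (finrank K V) j := by
  let _ := Fintype.ofFinite K
  have : Finite V := Module.finite_of_finite K
  have hq := one_lt_card_field K
  rcases lt_or_ge (finrank K V) j with h | h
  · rw [qBinom_eq_zero_of_lt h]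
    have : IsEmpty {S : Submodule K V // finrank K S = j} :=
      ⟨fun S => by have := S.2; have := S.1.finrank_le; omega⟩
    simp
  have hq' : 1 < Fintype.card K := Fintype.one_lt_card
  let f : {s : Fin j → V // LinearIndependent K s} → {S : Submodule K V // finrank K S = j} :=
    fun s => ⟨Submodule.span K (Set.range s.1), by rw [finrank_span_eq_card s.2]; simp⟩
  have key : Nat.card {s : Fin j → V // LinearIndependent K s} =
      Nat.card {S : Submodule K V // finrank K S = j} *
        ∏ i : Fin j, (Fintype.card K ^ j - Fintype.card K ^ (i : ℕ)) := by
    rw [← Nat.card_congr (Equiv.sigmaFiberEquiv f), Nat.card_sigma,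
      sum_congr rfl (g := fun _ => ∏ i : Fin j, (Fintype.card K ^ j - Fintype.card K ^ (i : ℕ)))]
    · simp [Nat.card_eq_fintype_card]
    · intro S _
      have hS := card_linearIndependent (K := K) (V := S.1) S.2.ge
      rw [S.2] at hS
      rw [← hS, ← Nat.card_congr (linearIndependentFiberEquiv S.1 S.2)]
      refine Nat.card_congr (Equiv.subtypeEquivRight fun s => ?_)
      exact Subtype.ext_iff
  rw [card_linearIndependent h] at key
  have key' := congrArg (Nat.cast (R := ℝ)) key
  rw [Nat.cast_mul, natCast_prod_pow_sub hq' h, natCast_prod_pow_sub hq' le_rfl,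
    ← Nat.card_eq_fintype_card, ← qBinom_mul_prod hq] at key'
  refine (mul_right_cancel₀ ?_ key').symm
  refine prod_ne_zero_iff.2 fun i hi => sub_ne_zero.2 ?_
  exact (pow_lt_pow_right₀ hq (mem_range.1 hi)).ne'

theorem card_subspaces_above (T : Submodule K V) {j : ℕ} (hj : finrank K T ≤ j) :
    (Nat.card {S : Submodule K V // T ≤ S ∧ finrank K S = j} : ℝ) =
      qBinom (Nat.card K) (finrank K V - finrank K T) (j - finrank K T) := by
  rw [← Submodule.finrank_quotient, ← card_subspaces]
  congr 1
  refine Nat.card_congr (Equiv.symm ?_)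
  refine ((Submodule.comapMkQRelIso T).toEquiv.subtypeEquiv (q := fun S => finrank K S.1 = j)
    fun S => ?_).trans (Equiv.subtypeSubtypeEquivSubtypeInter (fun S => S ∈ Set.Ici T)
      (fun S => finrank K S = j))
  have h1 := Submodule.finrank_quotient_add_finrank T
  have h : finrank K (S.comap T.mkQ) = finrank K S + finrank K T := by
    have h2 := (T.mkQ.domRestrict (S.comap T.mkQ)).finrank_range_add_finrank_ker
    rw [LinearMap.range_domRestrict, Submodule.map_comap_eq_of_surjective T.mkQ_surjective,
      LinearMap.ker_domRestrict, Submodule.ker_mkQ] at h2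
    rw [← h2, ← (Submodule.submoduleOfEquivOfLe (Submodule.le_comap_mkQ T S)).finrank_eq]
    rfl
  change _ ↔ finrank K (S.comap T.mkQ) = j
  omega

theorem card_subspaces_between {T Z : Submodule K V} (hTZ : T ≤ Z) {j : ℕ}
    (hj : finrank K T ≤ j) :
    (#{S : Submodule K V | T ≤ S ∧ S ≤ Z ∧ finrank K S = j} : ℝ) =
      qBinom (Nat.card K) (finrank K Z - finrank K T) (j - finrank K T) := by
  have h := card_subspaces_above (T.submoduleOf Z) (j := j)
  have hf : finrank K (T.submoduleOf Z) = finrank K T :=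
    (Submodule.submoduleOfEquivOfLe hTZ).finrank_eq
  rw [hf] at h
  rw [← h hj, ← Fintype.card_subtype, ← Nat.card_eq_fintype_card]
  congr 1
  refine Nat.card_congr (Equiv.symm ?_)
  refine ((Submodule.MapSubtype.orderIso Z).toEquiv.subtypeEquiv
    (q := fun S => T ≤ S.1 ∧ finrank K S.1 = j) fun S => ?_).trans
      ((Equiv.subtypeSubtypeEquivSubtypeInter (fun S => S ≤ Z)
      (fun S => T ≤ S ∧ finrank K S = j)).trans (Equiv.subtypeEquivRight fun S => by tauto))
  change _ ↔ T ≤ S.map Z.subtype ∧ finrank K (S.map Z.subtype) = j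
  rw [Submodule.finrank_map_subtype_eq]
  refine and_congr_left fun _ => ⟨fun h x hx => ?_, fun h x hx => ?_⟩
  · exact ⟨⟨x, hTZ hx⟩, h hx, rfl⟩
  · obtain ⟨y, hy, hyx⟩ := h hx
    rwa [← Subtype.ext hyx]

end SubspaceCount

/-- All fibres of a surjective homomorphism are translates of one another. -/
theorem Nat.card_eq_mul_card_fiber {A B : Type*} [AddGroup A] [AddGroup B] [Finite A] [Finite B]
    (φ : A →+ B) (hφ : Function.Surjective φ) (b : B) :
    Nat.card A = Nat.card B * Nat.card {a // φ a = b} := by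
  have := Fintype.ofFinite B
  rw [← Nat.card_congr (Equiv.sigmaFiberEquiv φ), Nat.card_sigma,
    sum_congr rfl (g := fun _ => Nat.card {a // φ a = b})]
  · simp [Nat.card_eq_fintype_card]
  · intro c _
    obtain ⟨x, rfl⟩ := hφ b
    obtain ⟨y, rfl⟩ := hφ c
    refine Nat.card_congr ((Equiv.addRight (-y + x)).subtypeEquiv fun a => ?_)
    simp only [Equiv.coe_addRight, map_add, map_neg]
    constructor
    · intro h; simp [h]
    · intro h
      rw [← add_assoc, add_eq_right, add_neg_eq_zero] at h
      exact h

/-! ### Generators of a polar space through a common model of the forms -/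

namespace ClassicalForm

variable {K V : Type*} [Field K] [AddCommGroup V] [Module K V]

/-- A common description of the three classical forms: a reflexive sesquilinear form and a set of
singular vectors. On each line `y + K x` with `x` singular and `β y x = 1` there are exactly
`s` singular vectors. -/
structure Model (F : ClassicalForm K V) where
  σ : K →+* K
  invol : ∀ a, σ (σ a) = a
  β : V →ₛₗ[σ] V →ₗ[K] K
  sing : V → Prop
  s : ℕ
  refl : ∀ x y, β x y = 0 → β y x = 0
  sing_smul : ∀ (c : K) x, sing x → sing (c • x)
  sing_self : ∀ x, sing x → β x x = 0
  sing_add : ∀ x y, sing x → sing y → β x y = 0 → sing (x + y)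
  nondeg : ∀ x, sing x → (∀ y, β y x = 0) → x = 0
  card_sing : ∀ x y, sing x → β y x = 1 → Nat.card {a : K // sing (y + a • x)} = s
  isTI_iff : ∀ U : Submodule K V, F.IsTotallyIsotropic U ↔
    (∀ u ∈ U, sing u) ∧ ∀ u ∈ U, ∀ w ∈ U, β u w = 0

theorem isTotallyIsotropic_bot (F : ClassicalForm K V) : F.IsTotallyIsotropic ⊥ := by
  cases F <;> simp [IsTotallyIsotropic]

variable {F : ClassicalForm K V}

theorem IsTotallyIsotropic.mono {T U : Submodule K V} (hU : F.IsTotallyIsotropic U) (h : T ≤ U) :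
    F.IsTotallyIsotropic T := by
  cases F
  · exact fun u hu w hw => hU u (h hu) w (h hw)
  · exact fun u hu w hw => hU u (h hu) w (h hw)
  · exact fun u hu => hU u (h hu)

section Rank

variable [FiniteDimensional K V]

theorem bddAbove_rank (F : ClassicalForm K V) :
    BddAbove {d | ∃ U : Submodule K V, F.IsTotallyIsotropic U ∧ finrank K U = d} :=
  ⟨finrank K V, by rintro _ ⟨U, _, rfl⟩; exact U.finrank_le⟩

theorem IsTotallyIsotropic.finrank_le {U : Submodule K V} (hU : F.IsTotallyIsotropic U) :
    finrank K U ≤ F.rank :=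
  le_csSup F.bddAbove_rank ⟨U, hU, rfl⟩

theorem nonempty_generator (F : ClassicalForm K V) : Nonempty F.Generator := by
  obtain ⟨U, hU, h⟩ := Nat.sSup_mem
    (s := {d | ∃ U : Submodule K V, F.IsTotallyIsotropic U ∧ finrank K U = d})
    ⟨0, ⊥, F.isTotallyIsotropic_bot, finrank_bot K V⟩ F.bddAbove_rank
  exact ⟨⟨U, hU, h⟩⟩

end Rank

namespace Model

variable (M : F.Model)


theorem isTI_sup_span {T : Submodule K V} (hT : F.IsTotallyIsotropic T) {x : V} (hx : M.sing x)
    (h : ∀ t ∈ T, M.β t x = 0) : F.IsTotallyIsotropic (T ⊔ Submodule.span K {x}) := by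
  obtain ⟨h1, h2⟩ := (M.isTI_iff T).1 hT
  have hxx := M.sing_self x hx
  rw [M.isTI_iff]
  simp only [Submodule.mem_sup, Submodule.mem_span_singleton]
  refine ⟨?_, ?_⟩
  · rintro _ ⟨t, ht, _, ⟨c, rfl⟩, rfl⟩
    exact M.sing_add _ _ (h1 t ht) (M.sing_smul c x hx) (by simp [h t ht])
  · rintro _ ⟨t, ht, _, ⟨c, rfl⟩, rfl⟩ _ ⟨t', ht', _, ⟨c', rfl⟩, rfl⟩
    simp [h2 t ht t' ht', h t ht, M.refl t' x (h t' ht'), hxx]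

theorem finrank_sup_span [FiniteDimensional K V] {T : Submodule K V} {x : V} (hx : x ∉ T) :
    finrank K (T ⊔ Submodule.span K {x} : Submodule K V) = finrank K T + 1 := by
  have h1 := Submodule.finrank_sup_add_finrank_inf_eq T (Submodule.span K {x})
  have hx0 : x ≠ 0 := fun h => hx (h ▸ T.zero_mem)
  have h2 : T ⊓ Submodule.span K {x} = ⊥ := by
    rw [← disjoint_iff, Submodule.disjoint_span_singleton' hx0]
    exact hx
  rw [h2, finrank_bot, finrank_span_singleton hx0] at h1
  exact h1

theorem mem_generator [FiniteDimensional K V] (U : F.Generator) {x : V} (hx : M.sing x)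
    (h : ∀ u ∈ U.1, M.β u x = 0) : x ∈ U.1 := by
  by_contra hxU
  have := (M.isTI_sup_span U.2.1 hx h).finrank_le
  rw [finrank_sup_span hxU, U.2.2] at this
  omega

/-- The map from `V` to the dual of `U` induced by `β` is onto: a vector of `U` annihilated by its
range is singular and in the radical, hence zero. All fibres then have equal size. -/
theorem card_fiber [Finite K] [FiniteDimensional K V] {U : Submodule K V}
    (hU : F.IsTotallyIsotropic U) (f : U →ₗ[K] K) :
    Nat.card {y : V // ∀ u : U, M.β y u = f u} * Nat.card K ^ finrank K U =
      Nat.card K ^ finrank K V := by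
  have hfin : Finite V := Module.finite_of_finite K
  let Φ : V →ₛₗ[M.σ] (U →ₗ[K] K) := M.β.domRestrict₂ U
  have hσ : Function.Surjective M.σ := fun a => ⟨M.σ a, M.invol a⟩
  have : RingHomSurjective M.σ := ⟨hσ⟩
  have hΦ : Function.Surjective Φ := by
    rw [← LinearMap.range_eq_top]
    have h : (LinearMap.range Φ).dualCoannihilator = ⊥ := by
      rw [eq_bot_iff]
      intro u hu
      rw [Submodule.mem_dualCoannihilator] at hu
      rw [Submodule.mem_bot, ← Submodule.coe_eq_zero]
      exact M.nondeg _ (((M.isTI_iff U).1 hU).1 u u.2) fun y => hu _ ⟨y, rfl⟩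
    rw [← Subspace.dualCoannihilator_dualAnnihilator_eq (W := LinearMap.range Φ), h,
      Submodule.dualAnnihilator_bot]
  have hD : Finite (U →ₗ[K] K) := Module.finite_of_finite K
  have h := Nat.card_eq_mul_card_fiber Φ.toAddMonoidHom hΦ f
  rw [Module.natCard_eq_pow_finrank (K := K) (V := V),
    Module.natCard_eq_pow_finrank (K := K) (V := U →ₗ[K] K), 
    show finrank K (U →ₗ[K] K) = finrank K U from Subspace.dual_finrank_eq] at h
  rw [h, mul_comm]
  congr 1
  refine Nat.card_congr (Equiv.subtypeEquivRight fun y => ?_)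
  exact ⟨fun h => LinearMap.ext h, fun h u => LinearMap.congr_fun h u⟩

/-- The number of generators other than `U` through a hyperplane of `U`, up to a power of `q`. -/
theorem card_generators_through_hyperplane [Finite K] [FiniteDimensional K V] (U : F.Generator)
    {H : Submodule K V} (hHU : H ≤ U.1) (hH : finrank K H + 1 = F.rank) :
    Nat.card {Z : F.Generator // Z ≠ U ∧ H ≤ Z.1} * Nat.card K ^ (2 * F.rank) =
      M.s * Nat.card K ^ finrank K V := by
  have hfin : Finite V := Module.finite_of_finite K
  obtain ⟨x, hxU, hxH⟩ : ∃ x ∈ U.1, x ∉ H := by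
    refine Set.not_subset.1 fun h => ?_
    have := Submodule.finrank_mono (R := K) (show U.1 ≤ H from h)
    rw [U.2.2] at this
    omega
  have hUH : U.1 = H ⊔ Submodule.span K {x} := by
    refine (Submodule.eq_of_le_of_finrank_eq (sup_le hHU ?_) ?_).symm
    · rwa [Submodule.span_singleton_le_iff_mem]
    · rw [finrank_sup_span hxH, U.2.2, hH]
  obtain ⟨hs, hp⟩ := (M.isTI_iff _).1 U.2.1
  -- Prescribing `β y` on `U` by this `f` normalises the vectors `y` orthogonal to `H` but not to
  -- `x`.
  obtain ⟨f, hfx, hfH⟩ : ∃ f : U.1 →ₗ[K] K, f ⟨x, hxU⟩ = 1 ∧ ∀ h : U.1, (h : V) ∈ H → f h = 0 := by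
    obtain ⟨g, hg1, hg2⟩ := Submodule.exists_dual_map_eq_bot_of_notMem
      (p := H.submoduleOf U.1) (x := ⟨x, hxU⟩) hxH inferInstance
    refine ⟨(g ⟨x, hxU⟩)⁻¹ • g, by simp [hg1], fun h hh => ?_⟩
    have : g h ∈ (H.submoduleOf U.1).map g := ⟨h, hh, rfl⟩
    rw [hg2, Submodule.mem_bot] at this
    simp [this]
  let A := {y : V // ∀ u : U.1, M.β y u = f u}
  have hA : ∀ y : V, (∀ u : U.1, M.β y u = f u) ↔ (∀ h ∈ H, M.β y h = 0) ∧ M.β y x = 1 := by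
    intro y
    constructor
    · intro h
      exact ⟨fun u hu => by rw [h ⟨u, hHU hu⟩, hfH _ hu], by rw [h ⟨x, hxU⟩, hfx]⟩
    · rintro ⟨h1, h2⟩ ⟨u, hu⟩
      have hu' := hu
      rw [hUH, Submodule.mem_sup] at hu'
      obtain ⟨h, hh, z, hz, rfl⟩ := hu'
      obtain ⟨c, rfl⟩ := Submodule.mem_span_singleton.1 hz
      have e : (⟨h + c • x, hu⟩ : U.1) = ⟨h, hHU hh⟩ + c • ⟨x, hxU⟩ := rfl
      rw [e, map_add, map_smul, hfx, hfH _ hh, ← e]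
      simp [h1 h hh, h2]
  let B := {y : V // (∀ u : U.1, M.β y u = f u) ∧ M.sing y}
  -- `A` is stable under translation by multiples of `x`, and each translate line carries `s`
  -- singular vectors.
  have hAB : Nat.card B * Nat.card K = M.s * Nat.card A := by
    have e : (Σ y : A, {a : K // M.sing (y.1 + a • x)}) ≃ B × K :=
      { toFun := fun p => (⟨p.1.1 + p.2.1 • x, fun u => by
            simp [p.1.2 u, hp x hxU u u.2], p.2.2⟩, p.2.1)
        invFun := fun p => ⟨⟨p.1.1 - p.2 • x, fun u => by
            simp [p.1.2.1 u, hp x hxU u u.2]⟩, ⟨p.2, by simpa using p.1.2.2⟩⟩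
        left_inv := by
          rintro ⟨⟨y, hy⟩, ⟨a, ha⟩⟩
          exact Sigma.subtype_ext (Subtype.ext (by simp)) rfl
        right_inv := by
          rintro ⟨⟨y, hy⟩, a⟩
          simp }
    rw [← Nat.card_prod, ← Nat.card_congr e]
    have := Fintype.ofFinite A
    rw [Nat.card_sigma, sum_congr rfl (g := fun _ => M.s)]
    · simp [Nat.card_eq_fintype_card, mul_comm]
    · intro y _
      exact M.card_sing x y.1 (hs x hxU) (((hA y.1).1 y.2).2)
  have hZ : ∀ y : V, (∀ u : U.1, M.β y u = f u) → y ∉ H := by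
    intro y hy hyH
    have h1 := ((hA y).1 hy).2
    rw [hp y (hHU hyH) x hxU] at h1
    exact zero_ne_one h1
  let g : B → {Z : F.Generator // Z ≠ U ∧ H ≤ Z.1} := fun y =>
    ⟨⟨H ⊔ Submodule.span K {y.1}, M.isTI_sup_span (U.2.1.mono hHU) y.2.2
        fun t ht => M.refl _ _ (((hA y.1).1 y.2.1).1 t ht),
      by rw [finrank_sup_span (hZ y.1 y.2.1), hH]⟩, by
      refine ⟨fun h => ?_, le_sup_left⟩
      have h2 : y.1 ∈ U.1 := by
        exact (congrArg Subtype.val h).le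
          (Submodule.mem_sup_right (Submodule.mem_span_singleton_self _))
      have h1 := ((hA y.1).1 y.2.1).2
      rw [hp y.1 h2 x hxU] at h1
      exact zero_ne_one h1⟩
  -- The vectors of `B` that yield a given `Z` are the `y ∈ Z` with `β y x = 1`, a coset of `H` in
  -- `Z`.
  have hB : Nat.card B = Nat.card {Z : F.Generator // Z ≠ U ∧ H ≤ Z.1} * Nat.card H := by
    rw [← Nat.card_congr (Equiv.sigmaFiberEquiv g), Nat.card_sigma,
      sum_congr rfl (g := fun _ => Nat.card H)]
    · simp [Nat.card_eq_fintype_card]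
    · rintro ⟨Z, hZU, hHZ⟩ _
      obtain ⟨hZs, hZp⟩ := (M.isTI_iff _).1 Z.2.1
      obtain ⟨z, hzZ, hzH⟩ : ∃ z ∈ Z.1, z ∉ H := by
        refine Set.not_subset.1 fun h => ?_
        have := Submodule.finrank_mono (R := K) (show Z.1 ≤ H from h)
        rw [Z.2.2] at this
        omega
      have hZH : ∀ z ∈ Z.1, z ∉ H → H ⊔ Submodule.span K {z} = Z.1 := by
        intro z hz hzH
        refine (Submodule.eq_of_le_of_finrank_eq (sup_le hHZ ?_) ?_)
        · rwa [Submodule.span_singleton_le_iff_mem]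
        · rw [finrank_sup_span hzH, Z.2.2, hH]
      have hmem : ∀ z ∈ Z.1, M.β z x = 0 → z ∈ H := by
        intro z hz hzx
        by_contra hzH
        have hzU : z ∈ U.1 := by
          refine M.mem_generator U (hZs z hz) fun u hu => ?_
          rw [hUH, Submodule.mem_sup] at hu
          obtain ⟨h, hh, w, hw, rfl⟩ := hu
          obtain ⟨c, rfl⟩ := Submodule.mem_span_singleton.1 hw
          simp [hZp h (hHZ hh) z hz, M.refl _ _ hzx]
        apply hZU
        apply Subtype.ext
        rw [← hZH z hz hzH]
        refine Submodule.eq_of_le_of_finrank_eq (sup_le hHU ?_) ?_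
        · rwa [Submodule.span_singleton_le_iff_mem]
        · rw [finrank_sup_span hzH, U.2.2, hH]
      have hzx : M.β z x ≠ 0 := fun h => hzH (hmem z hzZ h)
      -- The form is `σ`-semilinear in its first argument, so the normalising scalar needs an
      -- application of `σ`.
      set y := M.σ (M.β z x)⁻¹ • z with hy
      have hyZ : y ∈ Z.1 := Z.1.smul_mem _ hzZ
      have hyx : M.β y x = 1 := by
        rw [hy, map_smulₛₗ, LinearMap.smul_apply, M.invol, smul_eq_mul, inv_mul_cancel₀ hzx]
      refine Nat.card_congr
        { toFun := fun w => ⟨w.1.1 - y, hmem _ (Z.1.sub_mem ?_ hyZ) ?_⟩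
          invFun := fun h => ⟨⟨h.1 + y, (hA _).2 ⟨fun u hu => ?_, ?_⟩, ?_⟩, ?_⟩
          left_inv := fun w => by simp
          right_inv := fun h => by simp }
      · have h : H ⊔ Submodule.span K {w.1.1} = Z.1 := congrArg (fun Z => Z.1.1) w.2
        exact h.le (Submodule.mem_sup_right (Submodule.mem_span_singleton_self _))
      · rw [map_sub, LinearMap.sub_apply, hyx, ((hA _).1 w.1.2.1).2, sub_self]
      · exact hZp _ (Z.1.add_mem (hHZ h.2) hyZ) _ (hHZ hu)
      · rw [map_add, LinearMap.add_apply, hyx, hp _ (hHU h.2) _ hxU, zero_add]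
      · exact hZs _ (Z.1.add_mem (hHZ h.2) hyZ)
      · apply Subtype.ext
        apply Subtype.ext
        refine hZH _ (Z.1.add_mem (hHZ h.2) hyZ) fun h2 => ?_
        have h3 := hp _ (hHU h2) _ hxU
        rw [map_add, LinearMap.add_apply, hyx, hp _ (hHU h.2) _ hxU, zero_add] at h3
        exact one_ne_zero h3
  have hAc := M.card_fiber U.2.1 f
  rw [U.2.2] at hAc
  have hHc := Module.natCard_eq_pow_finrank (K := K) (V := H)
  calc _ = (Nat.card {Z : F.Generator // Z ≠ U ∧ H ≤ Z.1} * Nat.card H * Nat.card K) *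
        Nat.card K ^ F.rank := by
        rw [hHc, mul_assoc (Nat.card {Z : F.Generator // Z ≠ U ∧ H ≤ Z.1}), ← pow_succ, hH]
        ring
    _ = M.s * (Nat.card A * Nat.card K ^ F.rank) := by rw [← hB, hAB, mul_assoc]
    _ = _ := by rw [hAc]

/-- If `T ∩ U` is a hyperplane of `T`, then a unique generator through `T` meets `U` in a
hyperplane. -/
theorem existsUnique_generator (M : F.Model) [FiniteDimensional K V] (U : F.Generator) {T : Submodule K V}
    (hT : F.IsTotallyIsotropic T) (h : finrank K (T ⊓ U.1 : Submodule K V) + 1 = finrank K T) :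
    ∃! Z : F.Generator, finrank K (Z.1 ⊓ U.1 : Submodule K V) + 1 = F.rank ∧ T ≤ Z.1 := by
  obtain ⟨x, hxT, hxU⟩ : ∃ x ∈ T, x ∉ U.1 := by
    refine Set.not_subset.1 fun hTU => ?_
    rw [inf_eq_left.2 (show T ≤ U.1 from hTU)] at h
    omega
  obtain ⟨hTs, hTp⟩ := (M.isTI_iff _).1 hT
  obtain ⟨hUs, hUp⟩ := (M.isTI_iff _).1 U.2.1
  have hTx : T = (T ⊓ U.1) ⊔ Submodule.span K {x} := by
    refine (Submodule.eq_of_le_of_finrank_eq (sup_le inf_le_left ?_) ?_).symm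
    · rwa [Submodule.span_singleton_le_iff_mem]
    · rw [finrank_sup_span fun hx => hxU (Submodule.mem_inf.1 hx).2, h]
  -- The generator is forced to be `(U ∩ x^⊥) + K x`, for any `x` in `T` outside `U`. As the kernel
  -- of a functional, `H` has codimension at most one in `U`, and since `H + K x` is totally
  -- isotropic it has codimension exactly one.
  let H : Submodule K V := U.1 ⊓ LinearMap.ker (M.β x)
  have hHx : ∀ u ∈ H, M.β u x = 0 := fun u hu => M.refl _ _ (Submodule.mem_inf.1 hu).2
  have hxH : x ∉ H := fun hx => hxU (Submodule.mem_inf.1 hx).1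
  have hTI := M.isTI_sup_span (U.2.1.mono (inf_le_left : H ≤ U.1)) (hTs x hxT) hHx
  have hH : finrank K H + 1 = F.rank := by
    have h1 := hTI.finrank_le
    rw [finrank_sup_span hxH] at h1
    have h2 := Submodule.finrank_sup_add_finrank_inf_eq U.1 (LinearMap.ker (M.β x))
    have h3 := (M.β x).finrank_range_add_finrank_ker
    have h4 := (LinearMap.range (M.β x)).finrank_le
    have h5 := (U.1 ⊔ LinearMap.ker (M.β x)).finrank_le
    rw [finrank_self] at h4
    rw [U.2.2] at h2
    change _ + finrank K H = _ at h2
    omega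
  refine ⟨⟨_, hTI, by rw [finrank_sup_span hxH, hH]⟩, ⟨?_, ?_⟩, ?_⟩
  · refine le_antisymm ?_ ?_
    · refine Nat.succ_le_iff.2 (lt_of_lt_of_eq ?_ U.2.2)
      have hle : (H ⊔ Submodule.span K {x}) ⊓ U.1 ≤ U.1 := inf_le_right
      refine lt_of_le_of_ne (Submodule.finrank_mono hle) fun heq => ?_
      have h2 := Submodule.eq_of_le_of_finrank_eq hle heq
      rw [inf_eq_right] at h2
      have h3 := Submodule.eq_of_le_of_finrank_eq h2
        (by rw [U.2.2, finrank_sup_span hxH, hH])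
      apply hxU
      rw [h3]
      exact Submodule.mem_sup_right (Submodule.mem_span_singleton_self _)
    · refine hH.symm.le.trans ?_
      have : H ≤ (H ⊔ Submodule.span K {x}) ⊓ U.1 := le_inf le_sup_left inf_le_left
      have := Submodule.finrank_mono (R := K) this
      exact Nat.succ_le_succ this
  · rw [hTx]
    refine sup_le_sup_right (le_inf inf_le_right fun u hu => ?_) _
    exact hTp x hxT u (Submodule.mem_inf.1 hu).1
  · rintro Z ⟨hZ, hTZ⟩
    obtain ⟨hZs, hZp⟩ := (M.isTI_iff _).1 Z.2.1
    have h1 : Z.1 ⊓ U.1 ≤ H := le_inf inf_le_right fun u hu =>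
      hZp x (hTZ hxT) u (Submodule.mem_inf.1 hu).1
    have h2 := Submodule.eq_of_le_of_finrank_eq h1 (by omega)
    apply Subtype.ext
    refine (Submodule.eq_of_le_of_finrank_eq (sup_le ?_ ?_) ?_).symm
    · exact h2.symm.le.trans inf_le_left
    · rw [Submodule.span_singleton_le_iff_mem]; exact hTZ hxT
    · rw [Z.2.2, finrank_sup_span hxH, hH]

end Model

end ClassicalForm

/-! ### The trace of an involution of a finite field -/

section Involution

variable {K : Type*} [Field K] [Finite K]

/-- The trace `a ↦ a + σ a` maps onto the fixed field, and its kernel is a multiple of the fixed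
field by a skew element. So all its fibres over fixed elements have the size of the fixed field. -/
theorem card_trace_fiber (σ : K →+* K) (hσ : σ ≠ RingHom.id K) (h2 : ∀ a, σ (σ a) = a) {b : K}
    (hb : σ b = b) :
    Nat.card {a : K // a + σ a = b} = Nat.card {a : K // σ a = a} ∧
      Nat.card K = Nat.card {a : K // σ a = a} ^ 2 := by
  let Fix : AddSubgroup K :=
    { carrier := {a | σ a = a}
      zero_mem' := map_zero σ
      add_mem' := fun {a b} ha hb => by
        simp only [Set.mem_ofPred_eq] at *
        rw [map_add, ha, hb]
      neg_mem' := fun {a} ha => by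
        simp only [Set.mem_ofPred_eq] at *
        rw [map_neg, ha] }
  let φ : K →+ Fix :=
    { toFun := fun a => ⟨a + σ a, by change σ (a + σ a) = a + σ a; rw [map_add, h2, add_comm]⟩
      map_zero' := by ext; simp
      map_add' := fun a b => by ext; simp; ring }
  obtain ⟨γ, hγ⟩ : ∃ γ, σ γ ≠ γ := by
    by_contra! h
    exact hσ (RingHom.ext h)
  -- If the trace vanished, its value at `1` would force characteristic two and its value at `γ`
  -- would then make `γ` fixed.
  obtain ⟨τ, hτ⟩ : ∃ τ, τ + σ τ ≠ 0 := by
    by_contra! h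
    have h1 := h 1
    rw [map_one] at h1
    apply hγ
    have h3 := h γ
    linear_combination h3 - γ * h1
  have hφ : Function.Surjective φ := by
    rintro ⟨c, hc⟩
    have hc' : σ c = c := hc
    refine ⟨c * (τ + σ τ)⁻¹ * τ, Subtype.ext ?_⟩
    change c * (τ + σ τ)⁻¹ * τ + σ (c * (τ + σ τ)⁻¹ * τ) = c
    rw [map_mul, map_mul, map_inv₀, map_add, h2, hc', add_comm (σ τ) τ]
    field_simp
  have hδ : γ - σ γ ≠ 0 := sub_ne_zero.2 (Ne.symm hγ)
  have h0 : Nat.card {a // φ a = 0} = Nat.card Fix := by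
    refine Nat.card_congr
      { toFun := fun a => ⟨a.1 * (γ - σ γ)⁻¹, ?_⟩
        invFun := fun a => ⟨a.1 * (γ - σ γ), Subtype.ext ?_⟩
        left_inv := fun a => Subtype.ext (by simp [hδ])
        right_inv := fun a => Subtype.ext (by simp [hδ]) }
    · have h : a.1 + σ a.1 = 0 := congrArg Subtype.val a.2
      change σ (a.1 * (γ - σ γ)⁻¹) = a.1 * (γ - σ γ)⁻¹
      rw [map_mul, map_inv₀, map_sub, h2, eq_neg_of_add_eq_zero_right h, ← neg_sub γ (σ γ), inv_neg]
      ring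
    · have h : σ a.1 = a.1 := a.2
      change a.1 * (γ - σ γ) + σ (a.1 * (γ - σ γ)) = 0
      rw [map_mul, map_sub, h2, h]
      ring
  have h1 := Nat.card_eq_mul_card_fiber φ hφ 0
  have h3 := Nat.card_eq_mul_card_fiber φ hφ ⟨b, hb⟩
  rw [h0] at h1
  have hpos : 0 < Nat.card Fix := Nat.card_pos
  constructor
  · have h4 := Nat.eq_of_mul_eq_mul_left hpos (h3.symm.trans h1)
    refine Eq.trans (Nat.card_congr (Equiv.subtypeEquivRight fun a => ?_)) h4
    rw [Subtype.ext_iff]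
    rfl
  · rw [h1, pow_two]
    rfl

end Involution

/-! ### The three classical forms fit the model -/

namespace ClassicalForm

variable {K V : Type*} [Field K] [Finite K] [AddCommGroup V] [Module K V] [FiniteDimensional K V]

/-- When every vector is singular, a generator equals its own orthogonal space. This fixes the
dimension in the alternating case. -/
theorem Model.finrank_of_sing {F : ClassicalForm K V} (M : F.Model) (h : ∀ x, M.sing x) :
    finrank K V = 2 * F.rank := by
  obtain ⟨U⟩ := F.nonempty_generator
  have h1 := M.card_fiber U.2.1 0
  have h2 : Nat.card {y : V // ∀ u : U.1, M.β y u = (0 : U.1 →ₗ[K] K) u} = Nat.card U.1 := by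
    refine Nat.card_congr (Equiv.subtypeEquivRight fun y => ⟨fun hy => ?_, fun hy u => ?_⟩)
    · exact M.mem_generator U (h y) fun u hu => M.refl _ _ (hy ⟨u, hu⟩)
    · exact ((M.isTI_iff _).1 U.2.1).2 y hy u u.2
  rw [h2, Module.natCard_eq_pow_finrank (K := K), U.2.2, ← pow_add] at h1
  have := Nat.pow_right_injective (Finite.one_lt_card (α := K)) h1
  omega

/-- Here `s` is `√q`, `q` and `1` in the Hermitian, alternating and quadratic cases. The identity
turns the hyperplane count `s q^(dim V - 2n)` into `q^(e+1)`. -/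
theorem exists_model (F : ClassicalForm K V) :
    ∃ M : F.Model, F.fieldOrder ^ (F.parameter + 1) * F.fieldOrder ^ (2 * F.rank) =
      M.s * F.fieldOrder ^ finrank K V := by
  have hq : (0 : ℝ) < Nat.card K := zero_lt_one.trans (one_lt_card_field K)
  cases F with
  | hermitian σ σ_ne σ_invol B herm nondeg =>
    have hrefl : ∀ x y, B x y = 0 → B y x = 0 := fun x y h => by rw [herm, h, map_zero]
    let M : (hermitian σ σ_ne σ_invol B herm nondeg).Model :=
      { σ := σ
        invol := σ_invol
        β := B
        sing := fun x => B x x = 0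
        s := Nat.card {a : K // σ a = a}
        refl := hrefl
        sing_smul := fun c x h => by simp [h]
        sing_self := fun x h => h
        sing_add := fun x y hx hy h => by simp [hx, hy, h, hrefl x y h]
        nondeg := fun x _ h => nondeg x fun y => hrefl _ _ (h y)
        card_sing := fun x y hx h => by
          -- The vector `y + a x` is isotropic exactly when the trace of `a` equals `-B y y`.
          rw [← (card_trace_fiber σ σ_ne σ_invol (b := -B y y)
            (by rw [map_neg, ← herm])).1]
          refine Nat.card_congr (Equiv.subtypeEquivRight fun a => ?_)
          have h' : B x y = 1 := by rw [herm, h, map_one]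
          simp only [map_add, map_smulₛₗ, LinearMap.add_apply, LinearMap.smul_apply, hx, h, h',
            smul_eq_mul, RingHom.id_apply]
          rw [eq_neg_iff_add_eq_zero]
          refine Eq.congr_left ?_
          ring
        isTI_iff := fun U => ⟨fun h => ⟨fun u hu => h u hu u hu, h⟩, fun h => h.2⟩ }
    refine ⟨M, ?_⟩
    have hs : (Nat.card K : ℝ) = (M.s : ℝ) ^ 2 := by
      exact_mod_cast (card_trace_fiber σ σ_ne σ_invol (map_zero σ)).2
    have hs' : (M.s : ℝ) = (Nat.card K : ℝ) ^ (1 / 2 : ℝ) := by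
      rw [← Real.sqrt_eq_rpow, hs, Real.sqrt_sq (Nat.cast_nonneg _)]
    rw [hs']
    simp only [fieldOrder, parameter]
    rw [← Real.rpow_natCast, ← Real.rpow_natCast, ← Real.rpow_add hq, ← Real.rpow_add hq]
    congr 1
    push_cast
    ring
  | alternating B alt nondeg =>
    have hrefl : ∀ x y, B x y = 0 → B y x = 0 := fun x y h => by
      have := LinearMap.IsAlt.neg (B := B) alt x y
      rw [← this, h, neg_zero]
    let M : (alternating B alt nondeg).Model :=
      { σ := RingHom.id K
        invol := fun _ => rfl
        β := B
        sing := fun _ => True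
        s := Nat.card K
        refl := hrefl
        sing_smul := fun _ _ _ => trivial
        sing_self := fun x _ => alt x
        sing_add := fun _ _ _ _ _ => trivial
        nondeg := fun x _ h => nondeg x fun y => hrefl _ _ (h y)
        card_sing := fun x y _ _ => Nat.card_congr (Equiv.subtypeUnivEquiv fun _ => trivial)
        isTI_iff := fun U => ⟨fun h => ⟨fun _ _ => trivial, h⟩, fun h => h.2⟩ }
    refine ⟨M, ?_⟩
    rw [M.finrank_of_sing fun _ => trivial]
    simp [fieldOrder, parameter, M]
  | quadratic Q nondeg =>
    let M : (quadratic Q nondeg).Model :=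
      { σ := RingHom.id K
        invol := fun _ => rfl
        β := QuadraticMap.polarBilin Q
        sing := fun x => Q x = 0
        s := 1
        refl := fun x y h => by
          rw [QuadraticMap.polarBilin_apply_apply] at *
          rwa [QuadraticMap.polar_comm]
        sing_smul := fun c x h => by rw [QuadraticMap.map_smul, h, smul_zero]
        sing_self := fun x h => by
          rw [QuadraticMap.polarBilin_apply_apply, QuadraticMap.polar_self, h, smul_zero]
        sing_add := fun x y hx hy h => by
          rwa [QuadraticMap.polarBilin_apply_apply, QuadraticMap.polar, hx, hy, sub_zero,
            sub_zero] at h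
        nondeg := fun x hx h => nondeg x hx fun y => by
          rw [QuadraticMap.polar_comm]
          exact h y
        card_sing := fun x y hx h => by
          have : ∀ a : K, Q (y + a • x) = 0 ↔ a = -Q y := fun a => by
            rw [QuadraticMap.map_add Q, QuadraticMap.map_smul, hx, QuadraticMap.polar_smul_right,
              ← QuadraticMap.polarBilin_apply_apply, h, eq_neg_iff_add_eq_zero]
            refine Eq.congr_left ?_
            simp
            ring
          rw [Nat.card_congr (Equiv.subtypeEquivRight this)]
          simp
        isTI_iff := fun U => ⟨fun h => ⟨h, fun u hu w hw => by
          rw [QuadraticMap.polarBilin_apply_apply, QuadraticMap.polar, h u hu, h w hw,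
            h _ (U.add_mem hu hw)]
          simp⟩, fun h => h.1⟩ }
    refine ⟨M, ?_⟩
    simp only [fieldOrder, parameter, M]
    rw [← Real.rpow_natCast, ← Real.rpow_natCast, ← Real.rpow_add hq, Nat.cast_one, one_mul]
    congr 1
    push_cast
    ring

end ClassicalForm

/-! ### The dual polar graph and the generators through a subspace -/

theorem sum_card_filter_comm {A B : Type*} (s : Finset A) (t : Finset B) (r : A → B → Prop)
    [∀ a b, Decidable (r a b)] :
    ∑ a ∈ s, (#{b ∈ t | r a b} : ℝ) = ∑ b ∈ t, (#{a ∈ s | r a b} : ℝ) := by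
  exact_mod_cast sum_card_bipartiteAbove_eq_sum_card_bipartiteBelow r

theorem threeTerm_congr {q x : ℝ} {n i : ℕ} (hi : i ≤ n) {f g : ℕ → ℝ}
    (h : ∀ j ≤ n, f j = g j) : threeTerm q x n f i = threeTerm q x n g i := by
  rw [threeTerm, threeTerm, h i hi, h (i - 1) (by omega)]
  rcases hi.lt_or_eq with h' | h'
  · rw [h (i + 1) h']
  · rw [h', Nat.sub_self, qInt_zero]
    ring

theorem threeTerm_sum {q x : ℝ} {n : ℕ} (i : ℕ) {ι : Type*} (s : Finset ι) (c : ι → ℝ)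
    (f : ι → ℕ → ℝ) : threeTerm q x n (fun i => ∑ j ∈ s, c j * f j i) i =
      ∑ j ∈ s, c j * threeTerm q x n (f j) i := by
  simp only [threeTerm, mul_sum, ← sum_add_distrib]
  exact sum_congr rfl fun j _ => by ring

namespace ClassicalForm

variable {K V : Type*} [Field K] [AddCommGroup V] [Module K V]

/-- The distance in the dual polar graph. -/
noncomputable def dist (F : ClassicalForm K V) (U W : F.Generator) : ℕ :=
  F.rank - finrank K (U.1 ⊓ W.1 : Submodule K V)

/-- The number `q ^ (e + 1)` of further generators through a hyperplane of a generator. -/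
noncomputable def thickness (F : ClassicalForm K V) : ℝ := F.fieldOrder ^ (F.parameter + 1)

theorem fieldOrder_gt [Finite K] (F : ClassicalForm K V) : 1 < F.fieldOrder := one_lt_card_field K

theorem thickness_pos [Finite K] (F : ClassicalForm K V) : 0 < F.thickness :=
  Real.rpow_pos_of_pos (zero_lt_one.trans F.fieldOrder_gt) _

variable {F : ClassicalForm K V}

theorem dist_le (U W : F.Generator) : F.dist U W ≤ F.rank := Nat.sub_le _ _

theorem dist_comm (U W : F.Generator) : F.dist U W = F.dist W U := by
  rw [dist, dist, inf_comm]

variable [FiniteDimensional K V]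

theorem finrank_inf_le (U W : F.Generator) :
    finrank K (U.1 ⊓ W.1 : Submodule K V) ≤ F.rank :=
  (Submodule.finrank_mono inf_le_left).trans U.2.2.le

theorem rank_sub_dist (U W : F.Generator) :
    F.rank - F.dist U W = finrank K (U.1 ⊓ W.1 : Submodule K V) :=
  Nat.sub_sub_self (finrank_inf_le U W)

theorem rel_iff {i : ℕ} (U W : F.Generator) : F.Rel i U W ↔ F.dist U W = i := by
  have := finrank_inf_le U W
  rw [Rel, dist]
  omega

theorem eq_of_le {U W : F.Generator} (h : U.1 ≤ W.1) : U = W :=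
  Subtype.ext (Submodule.eq_of_le_of_finrank_eq h (U.2.2.trans W.2.2.symm))

theorem dist_eq_zero {U W : F.Generator} : F.dist U W = 0 ↔ U = W := by
  constructor
  · intro h
    have h1 := rank_sub_dist U W
    rw [h, Nat.sub_zero] at h1
    refine eq_of_le ?_
    rw [← inf_eq_left]
    exact Submodule.eq_of_le_of_finrank_eq inf_le_left (U.2.2.trans h1).symm
  · rintro rfl
    rw [dist, inf_idem]
    have := U.2.2
    omega

theorem dist_eq_one_iff {U W : F.Generator} :
    F.dist U W = 1 ↔ finrank K (U.1 ⊓ W.1 : Submodule K V) + 1 = F.rank := by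
  rw [← rel_iff, Rel]

variable [Finite K]

theorem card_generators_ne (U : F.Generator) {H : Submodule K V} (hHU : H ≤ U.1)
    (hH : finrank K H + 1 = F.rank) :
    (#{Z : F.Generator | Z ≠ U ∧ H ≤ Z.1} : ℝ) = F.thickness := by
  obtain ⟨M, hM⟩ := F.exists_model
  have h := congrArg (Nat.cast (R := ℝ)) (M.card_generators_through_hyperplane U hHU hH)
  rw [Nat.card_eq_fintype_card, Fintype.card_subtype] at h
  push_cast at h
  have hq : F.fieldOrder ^ (2 * F.rank) ≠ 0 := by
    have := F.fieldOrder_gt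
    positivity
  exact mul_right_cancel₀ hq (h.trans hM.symm)

/-- A neighbour `Z` through `T` is determined by the hyperplane `U ∩ Z ⊇ T` of `U` and one of the
`x` further generators on it. -/
theorem card_neighbors_of_le (U : F.Generator) {T : Submodule K V} (hTU : T ≤ U.1) :
    (#{Z : F.Generator | F.dist U Z = 1 ∧ T ≤ Z.1} : ℝ) =
      F.thickness * qInt F.fieldOrder (F.rank - finrank K T) := by
  have hT : finrank K T ≤ F.rank := (Submodule.finrank_mono hTU).trans U.2.2.le
  rcases hT.lt_or_eq with hT | hT
  · have hf : ∀ Z ∈ ({Z : F.Generator | F.dist U Z = 1 ∧ T ≤ Z.1} : Finset _),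
        U.1 ⊓ Z.1 ∈ ({H : Submodule K V | T ≤ H ∧ H ≤ U.1 ∧ finrank K H = F.rank - 1} :
          Finset _) := by
      intro Z hZ
      simp only [mem_filter, mem_univ, true_and, dist_eq_one_iff] at hZ ⊢
      exact ⟨le_inf hTU hZ.2, inf_le_left, by omega⟩
    rw [card_eq_sum_card_fiberwise hf, Nat.cast_sum, sum_congr rfl (g := fun _ => F.thickness)]
    · rw [sum_const, nsmul_eq_mul, card_subspaces_between hTU (by omega), U.2.2, mul_comm]
      congr 1
      obtain ⟨d, hd⟩ : ∃ d, F.rank - finrank K T = d + 1 := ⟨F.rank - finrank K T - 1, by omega⟩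
      rw [hd, show F.rank - 1 - finrank K T = d by omega]
      exact qBinom_succ_self (one_lt_card_field K) d
    · intro H hH
      simp only [mem_filter, mem_univ, true_and] at hH
      have hH' : finrank K H + 1 = F.rank := by omega
      rw [← card_generators_ne U hH.2.1 hH', filter_filter]
      congr 2
      ext Z
      simp only [mem_filter, mem_univ, true_and]
      constructor
      · rintro ⟨⟨h1, h2⟩, rfl⟩
        refine ⟨?_, inf_le_right⟩
        rintro rfl
        rw [dist_eq_zero.2 rfl] at h1
        omega
      · rintro ⟨h1, h2⟩
        have h3 : finrank K (U.1 ⊓ Z.1 : Submodule K V) < F.rank := by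
          rw [← rank_sub_dist]
          have : F.dist U Z ≠ 0 := fun h => h1 (dist_eq_zero.1 h).symm
          omega
        have h4 : H ≤ U.1 ⊓ Z.1 := le_inf hH.2.1 h2
        have h5 := Submodule.finrank_mono (R := K) h4
        have h6 := Submodule.eq_of_le_of_finrank_eq h4 (by omega)
        exact ⟨⟨dist_eq_one_iff.2 (by omega), hH.1.trans h2⟩, h6.symm⟩
  · rw [hT, Nat.sub_self, qInt_zero, mul_zero, Nat.cast_eq_zero, card_eq_zero,
      filter_eq_empty_iff]
    rintro Z _ ⟨h1, h2⟩
    have h3 := Submodule.eq_of_le_of_finrank_eq hTU (hT.trans U.2.2.symm)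
    rw [h3] at h2
    rw [dist_eq_zero.2 (eq_of_le h2)] at h1
    omega

/-- One formula covers three cases. If `T ≤ U`, all `[dim T]` hyperplanes of `T` lie in `U`, and
they cancel the negative part of `eigen`. If `T ∩ U` is a hyperplane of `T`, both sides are `1` by
`existsUnique_generator`. Otherwise both are `0`. -/
theorem card_neighbors (U : F.Generator) {T : Submodule K V} (hT : F.IsTotallyIsotropic T) :
    (#{Z : F.Generator | F.dist U Z = 1 ∧ T ≤ Z.1} : ℝ) =
      (if T ≤ U.1 then eigen F.fieldOrder F.thickness F.rank (finrank K T) else 0) +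
        #{S : Submodule K V | S ≤ U.1 ∧ finrank K S + 1 = finrank K T ∧ S ≤ T} := by
  by_cases hTU : T ≤ U.1
  · rw [if_pos hTU, card_neighbors_of_le U hTU, eigen]
    rcases Nat.eq_zero_or_pos (finrank K T) with h0 | h0
    · simp [h0, qInt_zero]
    · have h := card_subspaces_between (bot_le : ⊥ ≤ T) (j := finrank K T - 1) (by simp)
      have h2 := qBinom_succ_self (one_lt_card_field K) (finrank K T - 1)
      rw [Nat.sub_add_cancel h0] at h2
      rw [finrank_bot, Nat.sub_zero, Nat.sub_zero, h2] at h
      rw [fieldOrder, ← h, sub_add, eq_comm, sub_eq_self, sub_eq_zero]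
      congr 2
      ext S
      simp only [mem_filter, mem_univ, true_and, bot_le]
      constructor
      · rintro ⟨h1, h2⟩
        exact ⟨h1.trans hTU, by omega, h1⟩
      · rintro ⟨_, h1, h2⟩
        exact ⟨h2, by omega⟩
  · rw [if_neg hTU, zero_add]
    have hlt : finrank K (T ⊓ U.1 : Submodule K V) < finrank K T := by
      refine Submodule.finrank_lt_finrank_of_lt (lt_of_le_of_ne inf_le_left fun h => hTU ?_)
      exact inf_eq_left.1 h
    by_cases h : finrank K (T ⊓ U.1 : Submodule K V) + 1 = finrank K T
    · obtain ⟨M, -⟩ := F.exists_model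
      obtain ⟨Z, ⟨hZ1, hZ2⟩, hZ3⟩ := M.existsUnique_generator U hT h
      congr 1
      trans 1
      · rw [card_eq_one]
        refine ⟨Z, ?_⟩
        ext W
        simp only [mem_filter, mem_univ, true_and, mem_singleton, dist_eq_one_iff]
        rw [inf_comm]
        exact ⟨fun hW => hZ3 W hW, by rintro rfl; exact ⟨hZ1, hZ2⟩⟩
      · rw [eq_comm, card_eq_one]
        refine ⟨T ⊓ U.1, ?_⟩
        ext S
        simp only [mem_filter, mem_univ, true_and, mem_singleton]
        constructor
        · rintro ⟨h1, h2, h3⟩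
          exact Submodule.eq_of_le_of_finrank_eq (le_inf h3 h1) (by omega)
        · rintro rfl
          exact ⟨inf_le_right, h, inf_le_left⟩
    · rw [filter_false_of_mem, filter_false_of_mem]
      · simp
      · rintro S _ ⟨h1, h2, h3⟩
        have := Submodule.finrank_mono (R := K) (le_inf h3 h1)
        omega
      · rintro Z _ ⟨h1, h2⟩
        rw [dist_eq_one_iff] at h1
        -- Inside `Z`, the space `T` meets the hyperplane `U ∩ Z` in codimension at most one,
        -- contrary to the case assumption.
        have h3 := Submodule.finrank_sup_add_finrank_inf_eq T (U.1 ⊓ Z.1)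
        have h4 := Submodule.finrank_mono (R := K) (sup_le h2 inf_le_right : T ⊔ U.1 ⊓ Z.1 ≤ Z.1)
        have h5 : T ⊓ (U.1 ⊓ Z.1) ≤ T ⊓ U.1 := inf_le_inf_left _ inf_le_left
        have h6 := Submodule.finrank_mono (R := K) h5
        have := Z.2.2
        omega

theorem card_subspaces_inf (U W : F.Generator) (j : ℕ) :
    (#{T : Submodule K V | (T ≤ U.1 ∧ finrank K T = j) ∧ T ≤ W.1} : ℝ) =
      qBinom F.fieldOrder (F.rank - F.dist U W) j := by
  have h := card_subspaces_between (bot_le : ⊥ ≤ U.1 ⊓ W.1) (j := j) (by simp)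
  rw [finrank_bot, Nat.sub_zero, Nat.sub_zero] at h
  rw [rank_sub_dist, fieldOrder, ← h]
  congr 2
  ext T
  simp only [mem_filter, mem_univ, true_and, bot_le, le_inf_iff]
  tauto

/-- Sum `card_neighbors` over the `j`-spaces `T` of `W`. In the second term, each `(j-1)`-space of
`U ∩ W` extends to `[n+1-j]` spaces `T` inside `W`. -/
theorem sum_neighbors_qBinom (U W : F.Generator) (j : ℕ) :
    ∑ Z ∈ ({Z : F.Generator | F.dist U Z = 1} : Finset _),
        qBinom F.fieldOrder (F.rank - F.dist W Z) j =
      eigen F.fieldOrder F.thickness F.rank j * qBinom F.fieldOrder (F.rank - F.dist W U) j +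
        (if j = 0 then 0 else qInt F.fieldOrder (F.rank + 1 - j) *
          qBinom F.fieldOrder (F.rank - F.dist W U) (j - 1)) := by
  have h1 : ∑ Z ∈ ({Z : F.Generator | F.dist U Z = 1} : Finset _),
        qBinom F.fieldOrder (F.rank - F.dist W Z) j =
      ∑ T ∈ ({T : Submodule K V | T ≤ W.1 ∧ finrank K T = j} : Finset _),
        (#{Z : F.Generator | F.dist U Z = 1 ∧ T ≤ Z.1} : ℝ) := by
    simp only [← card_subspaces_inf, ← filter_filter (fun Z => F.dist U Z = 1),
      ← filter_filter (fun T : Submodule K V => T ≤ W.1 ∧ finrank K T = j)]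
    exact sum_card_filter_comm _ _ fun (Z : F.Generator) (T : Submodule K V) => T ≤ Z.1
  rw [h1]
  have h2 : ∀ T ∈ ({T : Submodule K V | T ≤ W.1 ∧ finrank K T = j} : Finset _),
      (#{Z : F.Generator | F.dist U Z = 1 ∧ T ≤ Z.1} : ℝ) =
        eigen F.fieldOrder F.thickness F.rank j * (if T ≤ U.1 then 1 else 0) +
        #{S ∈ ({S | S ≤ U.1 ∧ finrank K S + 1 = j} : Finset (Submodule K V)) | S ≤ T} := by
    intro T hT
    simp only [mem_filter, mem_univ, true_and] at hT
    rw [card_neighbors U (W.2.1.mono hT.1), hT.2, mul_ite, mul_one, mul_zero, filter_filter]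
    simp only [and_assoc]
  rw [sum_congr rfl h2, sum_add_distrib, ← mul_sum, sum_boole, filter_filter, card_subspaces_inf,
    sum_card_filter_comm _ _ fun (T S : Submodule K V) => S ≤ T]
  congr 1
  rcases j with _ | j
  · simp
  rw [if_neg (Nat.succ_ne_zero j), Nat.add_sub_cancel, ← card_subspaces_inf,
    mul_comm (qInt _ _)]
  have h3 : ({S : Submodule K V | S ≤ U.1 ∧ finrank K S + 1 = j + 1} : Finset _) =
      ({S : Submodule K V | S ≤ U.1 ∧ finrank K S = j} : Finset _) := by
    ext S; simp
  rw [h3, ← filter_filter (fun S : Submodule K V => S ≤ W.1 ∧ finrank K S = j) (fun S => S ≤ U.1),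
    filter_filter, ← nsmul_eq_mul, ← sum_const]
  have h4 : ({S : Submodule K V | (S ≤ W.1 ∧ finrank K S = j) ∧ S ≤ U.1} : Finset _) =
      ({S ∈ ({S : Submodule K V | S ≤ U.1 ∧ finrank K S = j} : Finset _) | S ≤ W.1} :
        Finset (Submodule K V)) := by
    ext S
    simp only [mem_filter, mem_univ, true_and]
    tauto
  rw [h4, sum_filter fun S : Submodule K V => S ≤ W.1]
  refine sum_congr rfl fun S hS => ?_
  simp only [mem_filter, mem_univ, true_and] at hS
  split_ifs with hSW
  · have h5 := card_subspaces_between hSW (j := j + 1) (by omega)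
    rw [W.2.2, hS.2, Nat.add_sub_cancel_left, qBinom_one_right] at h5
    rw [Nat.add_sub_add_right, fieldOrder, ← h5, filter_filter]
    congr 2
    ext T
    simp only [mem_filter, mem_univ, true_and]
    tauto
  · rw [Nat.cast_eq_zero, card_eq_zero, filter_eq_empty_iff]
    intro T hT hST
    simp only [mem_filter, mem_univ, true_and] at hT
    exact hSW (hST.trans hT.1)

/-- The adjacency matrix of the dual polar graph acts on functions of the distance by
`threeTerm`. -/
theorem sum_neighbors (U W : F.Generator) (f : ℕ → ℝ) :
    ∑ Z ∈ ({Z : F.Generator | F.dist U Z = 1} : Finset _), f (F.dist W Z) =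
      threeTerm F.fieldOrder F.thickness F.rank f (F.dist W U) := by
  -- On the basis `binom(n-i, j)` the geometric and algebraic formulas agree, so neighbours need not
  -- be counted distance by distance.
  obtain ⟨c, hc⟩ := exists_qBinom_expansion F.fieldOrder_gt (fun m => f (F.rank - m)) F.rank
  have hf : ∀ i ≤ F.rank, f i =
      ∑ j ∈ range (F.rank + 1), c j * qBinom F.fieldOrder (F.rank - i) j := by
    intro i hi
    rw [← hc _ (Nat.sub_le _ _), Nat.sub_sub_self hi]
  rw [threeTerm_congr (dist_le _ _) hf, threeTerm_sum, sum_congr rfl fun Z _ => hf _ (dist_le W Z),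
    sum_comm]
  refine sum_congr rfl fun j hj => ?_
  rw [← mul_sum, sum_neighbors_qBinom, threeTerm_qBinom F.fieldOrder_gt (dist_le _ _)
    (Nat.lt_succ_iff.1 (mem_range.1 hj))]

/-- Count adjacent pairs `(U, Z)` with `T ≤ Z` in two ways: from `Z` by the valency `x [n]`, and
from `U` by `card_neighbors`. -/
theorem card_through_recursion {T : Submodule K V} (hT : F.IsTotallyIsotropic T) :
    (F.thickness * qInt F.fieldOrder F.rank) * #{Z : F.Generator | T ≤ Z.1} =
      eigen F.fieldOrder F.thickness F.rank (finrank K T) * #{Z : F.Generator | T ≤ Z.1} +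
      ∑ S ∈ ({S : Submodule K V | finrank K S + 1 = finrank K T ∧ S ≤ T} : Finset _),
        (#{Z : F.Generator | S ≤ Z.1} : ℝ) := by
  have h1 : ∑ U : F.Generator, (#{Z : F.Generator | F.dist U Z = 1 ∧ T ≤ Z.1} : ℝ) =
      (F.thickness * qInt F.fieldOrder F.rank) * #{Z : F.Generator | T ≤ Z.1} := by
    have e : ∀ U : F.Generator, ({Z : F.Generator | F.dist U Z = 1 ∧ T ≤ Z.1} : Finset _) =
        {Z ∈ ({Z | T ≤ Z.1} : Finset F.Generator) | F.dist U Z = 1} := fun U => by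
      rw [filter_filter]
      exact filter_congr fun Z _ => and_comm
    simp only [e]
    rw [sum_card_filter_comm _ _ fun (U Z : F.Generator) => F.dist U Z = 1,
      sum_congr rfl (g := fun _ => F.thickness * qInt F.fieldOrder F.rank), sum_const,
      nsmul_eq_mul, mul_comm]
    intro Z _
    have := card_neighbors_of_le Z (bot_le : ⊥ ≤ Z.1)
    simp only [bot_le, and_true, finrank_bot, Nat.sub_zero] at this
    simp only [dist_comm _ Z, this]
  rw [← h1, sum_congr rfl fun U _ => card_neighbors U hT, sum_add_distrib, ← sum_filter, sum_const,
    nsmul_eq_mul, mul_comm]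
  congr 1
  have e : ∀ U : F.Generator,
      ({S : Submodule K V | S ≤ U.1 ∧ finrank K S + 1 = finrank K T ∧ S ≤ T} : Finset _) =
      {S ∈ ({S | finrank K S + 1 = finrank K T ∧ S ≤ T} : Finset (Submodule K V)) | S ≤ U.1} :=
    fun U => by
      rw [filter_filter]
      exact filter_congr fun Z _ => and_comm
  simp only [e]
  exact sum_card_filter_comm _ _ fun (U : F.Generator) (S : Submodule K V) => S ≤ U.1

theorem card_through_mul {T : Submodule K V} (hT : F.IsTotallyIsotropic T) :
    (#{Z : F.Generator | T ≤ Z.1} : ℝ) *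
      ∏ l ∈ range (finrank K T), (1 + F.fieldOrder ^ (F.rank - 1 - l) * F.thickness) =
      Fintype.card F.Generator := by
  have hq := F.fieldOrder_gt
  induction h : finrank K T generalizing T with
  | zero =>
    rw [Submodule.finrank_eq_zero.1 h]
    simp [Finset.card_univ]
  | succ j ih =>
    have h1 := card_through_recursion hT
    have hjr : j + 1 ≤ F.rank := h ▸ hT.finrank_le
    set P := ∏ l ∈ range j, (1 + F.fieldOrder ^ (F.rank - 1 - l) * F.thickness) with hP
    have hP0 : P ≠ 0 := by
      refine (prod_pos fun l _ => ?_).ne'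
      have := F.thickness_pos
      positivity
    have h2 : ∀ S ∈ ({S : Submodule K V | finrank K S + 1 = finrank K T ∧ S ≤ T} : Finset _),
        (#{Z : F.Generator | S ≤ Z.1} : ℝ) = Fintype.card F.Generator / P := by
      intro S hS
      simp only [mem_filter, mem_univ, true_and] at hS
      rw [eq_div_iff hP0, hP]
      exact ih (hT.mono hS.2) (by omega)
    have h3 : (#{S : Submodule K V | finrank K S + 1 = finrank K T ∧ S ≤ T} : ℝ) =
        qInt F.fieldOrder (j + 1) := by
      have h4 := card_subspaces_between (bot_le : ⊥ ≤ T) (j := j) (by simp)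
      rw [finrank_bot, Nat.sub_zero, Nat.sub_zero, h, qBinom_succ_self (one_lt_card_field K)] at h4
      rw [fieldOrder, ← h4]
      congr 2
      ext S
      simp only [mem_filter, mem_univ, true_and, bot_le, h, add_left_inj]
      exact and_comm
    rw [sum_congr rfl h2, sum_const, nsmul_eq_mul, h3, h, eigen] at h1
    rw [prod_range_succ, ← hP]
    -- With this splitting of `[n]`, the recursion loses the common factor `[j+1]`, leaving the new
    -- factor `1 + q^(n-1-j) x`.
    have h5 : qInt F.fieldOrder F.rank = qInt F.fieldOrder (F.rank - (j + 1)) +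
        F.fieldOrder ^ (F.rank - 1 - j) * qInt F.fieldOrder (j + 1) := by
      have e1 : F.fieldOrder ^ F.rank =
          F.fieldOrder ^ (F.rank - 1 - j) * F.fieldOrder ^ (j + 1) := by
        rw [← pow_add]; congr 1; omega
      have e2 : F.rank - (j + 1) = F.rank - 1 - j := by omega
      rw [e2, qInt, qInt, qInt, e1]
      have : F.fieldOrder - 1 ≠ 0 := by linarith
      field_simp
      ring
    refine mul_left_cancel₀ (qInt_ne_zero hq (Nat.succ_ne_zero j)) ?_
    rw [h5] at h1
    have h6 : (Fintype.card F.Generator : ℝ) = Fintype.card F.Generator / P * P := by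
      field_simp
    rw [h6]
    linear_combination P * h1

/-- Each generator through `T` contains the same number `b` of `t`-spaces through `T`. Double
counting these flags in `Y` and in all of `X`, where each `t`-space lies in one and in `|X| / P t`
generators respectively, eliminates `b`. -/
theorem card_through (F : ClassicalForm K V) {T : Submodule K V} (hT : F.IsTotallyIsotropic T)
    {t : ℕ} {Y : Finset F.Generator} (hY : F.IsSteinerSystem t Y) (htn : t ≤ F.rank)
    (hTt : finrank K T ≤ t) :
    (#{Z ∈ Y | T ≤ Z.1} : ℝ) =
      ∏ l ∈ Ico (finrank K T) t, (1 + F.fieldOrder ^ (F.rank - 1 - l) * F.thickness) := by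
  have hq := F.fieldOrder_gt
  have hpos : ∀ l, 0 < 1 + F.fieldOrder ^ (F.rank - 1 - l) * F.thickness := fun l => by
    have := F.thickness_pos
    positivity
  set b := qBinom F.fieldOrder (F.rank - finrank K T) (t - finrank K T) with hb
  have hb0 : b ≠ 0 := (qBinom_pos hq (by omega)).ne'
  set S := ({S : Submodule K V | F.IsTotallyIsotropic S ∧ T ≤ S ∧ finrank K S = t} : Finset _)
  have hZ : ∀ Z : F.Generator, T ≤ Z.1 → (#{S' ∈ S | S' ≤ Z.1} : ℝ) = b := by
    intro Z hTZ
    have h := card_subspaces_between hTZ hTt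
    rw [Z.2.2] at h
    rw [hb, fieldOrder, ← h, filter_filter]
    congr 2
    ext S'
    simp only [mem_filter, mem_univ, true_and]
    exact ⟨fun h => ⟨h.1.2.1, h.2, h.1.2.2⟩, fun h => ⟨⟨Z.2.1.mono h.2.1, h.1, h.2.2⟩, h.2.1⟩⟩
  have hgen : ∀ Y' : Finset F.Generator, (#{Z ∈ Y' | T ≤ Z.1} : ℝ) * b =
      ∑ S' ∈ S, (#{Z ∈ Y' | S' ≤ Z.1} : ℝ) := by
    intro Y'
    rw [← nsmul_eq_mul, ← sum_const, ← sum_congr rfl fun Z hZ' => hZ Z (mem_filter.1 hZ').2,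
      sum_card_filter_comm _ _ fun (Z : F.Generator) (S' : Submodule K V) => S' ≤ Z.1]
    refine sum_congr rfl fun S' hS' => ?_
    rw [filter_filter]
    congr 2
    ext Z
    simp only [S, mem_filter, mem_univ, true_and] at hS' ⊢
    exact ⟨fun h => ⟨h.1, h.2.2⟩, fun h => ⟨h.1, hS'.2.1.trans h.2, h.2⟩⟩
  have h1 := hgen Y
  have h2 := hgen univ
  have h3 : ∀ S' ∈ S, (#{Z ∈ Y | S' ≤ Z.1} : ℝ) = 1 := by
    intro S' hS'
    simp only [S, mem_filter, mem_univ, true_and] at hS'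
    obtain ⟨Z, hZ1, hZ2⟩ := hY S' hS'.1 hS'.2.2
    rw [Nat.cast_eq_one, card_eq_one]
    refine ⟨Z, ?_⟩
    ext W
    rw [mem_filter, mem_singleton]
    exact ⟨fun h => hZ2 W h, by rintro rfl; exact hZ1⟩
  set P : ℕ → ℝ := fun j => ∏ l ∈ range j, (1 + F.fieldOrder ^ (F.rank - 1 - l) * F.thickness)
    with hP
  have hP0 : ∀ j, P j ≠ 0 := fun j => (prod_pos fun l _ => hpos l).ne'
  have h4 : ∀ S' ∈ S, (#{Z : F.Generator | S' ≤ Z.1} : ℝ) = Fintype.card F.Generator / P t := by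
    intro S' hS'
    simp only [S, mem_filter, mem_univ, true_and] at hS'
    rw [eq_div_iff (hP0 t), ← hS'.2.2]
    exact card_through_mul hS'.1
  rw [sum_congr rfl h3, sum_const, nsmul_one] at h1
  rw [sum_congr rfl h4, sum_const, nsmul_eq_mul, ← h1] at h2
  have h5 := card_through_mul hT
  have h6 : P (finrank K T) * ∏ l ∈ Ico (finrank K T) t,
      (1 + F.fieldOrder ^ (F.rank - 1 - l) * F.thickness) = P t := by
    simp only [hP]
    exact prod_range_mul_prod_Ico _ hTt
  have hX : (Fintype.card F.Generator : ℝ) ≠ 0 := by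
    have := F.nonempty_generator
    exact_mod_cast Fintype.card_ne_zero
  have h7 : (#{Z : F.Generator | T ≤ Z.1} : ℝ) * P (finrank K T) = Fintype.card F.Generator := h5
  have h8 := hP0 t
  field_simp at h2
  refine mul_left_cancel₀ (mul_ne_zero hX (hP0 (finrank K T))) ?_
  rw [mul_assoc _ (P (finrank K T)) (∏ l ∈ _, _), h6, ← h7]
  linear_combination -P (finrank K T) * h2 + (#{Z ∈ Y | T ≤ Z.1} : ℝ) * P (finrank K T) * h7

end ClassicalForm

/-! ### Eigenvalues and minimal idempotents of the Bose-Mesner algebra -/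

theorem eigen_lt {q x : ℝ} (hq : 1 < q) (hx : 0 < x) {n k l : ℕ} (hkl : k < l) (hl : l ≤ n) :
    eigen q x n l < eigen q x n k := by
  have h1 : ∀ {a b : ℕ}, a ≤ b → qInt q a ≤ qInt q b := fun h =>
    div_le_div_of_nonneg_right (sub_le_sub_right (pow_le_pow_right₀ hq.le h) 1) (by linarith)
  have h2 : qInt q k < qInt q l :=
    div_lt_div_of_pos_right (sub_lt_sub_right (pow_lt_pow_right₀ hq hkl) 1) (by linarith)
  have h3 := mul_le_mul_of_nonneg_left (h1 (show n - l ≤ n - k by omega)) hx.le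
  rw [eigen, eigen]
  linarith

theorem eigen_ne {q x : ℝ} (hq : 1 < q) (hx : 0 < x) {n k l : ℕ} (hkl : k ≠ l) (hk : k ≤ n)
    (hl : l ≤ n) : eigen q x n k ≠ eigen q x n l := by
  rcases hkl.lt_or_gt with h | h
  · exact (eigen_lt hq hx h hl).ne'
  · exact (eigen_lt hq hx h hk).ne

theorem uNumber_zero (q x : ℝ) (n k : ℕ) : uNumber q x n k 0 = qBinom q n k := by
  rw [uNumber, sum_range_succ', sum_eq_zero]
  · simp [qBinom_zero_right]
  · intro l _
    simp [qBinom_zero_left]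

namespace ClassicalForm

variable {K V : Type*} [Field K] [AddCommGroup V] [Module K V] (F : ClassicalForm K V)

theorem valency_zero : F.valency 0 = 1 := by simp [valency, qBinom]

/-- The matrix whose entries are given by a function of the distance. -/
noncomputable def kernel (f : ℕ → ℝ) : Matrix F.Generator F.Generator ℂ :=
  Matrix.of fun U W => (f (F.dist U W) : ℂ)

theorem kernel_congr {f g : ℕ → ℝ} (h : ∀ i ≤ F.rank, f i = g i) : F.kernel f = F.kernel g := by
  ext U W
  simp only [kernel, Matrix.of_apply]
  rw [h _ (dist_le U W)]

theorem kernel_smul (c : ℝ) (f : ℕ → ℝ) : F.kernel (fun i => c * f i) = (c : ℂ) • F.kernel f := by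
  ext U W
  simp [kernel]

/-- The unnormalised idempotents. -/
noncomputable def eigenKernel (k : ℕ) : Matrix F.Generator F.Generator ℂ :=
  F.kernel (uNumber F.fieldOrder F.thickness F.rank k)

/-- The eigenvalue of the `k`-th unnormalised idempotent on itself. -/
noncomputable def eigenNorm (k : ℕ) : ℝ :=
  ∑ i : Fin (F.rank + 1), uNumber F.fieldOrder F.thickness F.rank k i * F.pNumber i k

/-- The coefficients of the minimal idempotents. -/
noncomputable def idemCoeff (k i : ℕ) : ℝ :=
  (F.eigenNorm k)⁻¹ * uNumber F.fieldOrder F.thickness F.rank k i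

/-- The minimal idempotents of the Bose-Mesner algebra. -/
noncomputable def idem (k : ℕ) : Matrix F.Generator F.Generator ℂ := F.kernel (F.idemCoeff k)

theorem idem_eq (k : ℕ) : F.idem k = ((F.eigenNorm k)⁻¹ : ℂ) • F.eigenKernel k := by
  rw [idem, eigenKernel, ← Complex.ofReal_inv, ← kernel_smul]
  rfl

section Adjacency

variable [FiniteDimensional K V]

theorem adjacency_eq (i : ℕ) : F.adjacency i = F.kernel fun j => if j = i then 1 else 0 := by
  ext U W
  simp only [adjacency, kernel, Matrix.of_apply, rel_iff]
  split_ifs <;> simp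

theorem adjacency_zero : F.adjacency 0 = 1 := by
  ext U W
  simp [adjacency, rel_iff, dist_eq_zero, Matrix.one_apply]

theorem kernel_eq_sum (f : ℕ → ℝ) :
    F.kernel f = ∑ i : Fin (F.rank + 1), (f i : ℂ) • F.adjacency i := by
  ext U W
  rw [Matrix.sum_apply]
  simp only [kernel, adjacency, Matrix.of_apply, rel_iff, Matrix.smul_apply, smul_eq_mul, mul_ite,
    mul_one, mul_zero]
  rw [sum_eq_single (⟨F.dist U W, Nat.lt_succ_of_le (dist_le U W)⟩ : Fin (F.rank + 1))]
  · simp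
  · intro i _ hi
    rw [if_neg]
    exact fun h => hi (Fin.ext h.symm)
  · simp

end Adjacency

variable [Finite K]

/-- The balance relation `v_{i+1} c_{i+1} = v_i b_i` between valencies and the coefficients of
`threeTerm`. It transposes the recurrence of `uNumber` into that of `pNumber`. -/
theorem valency_succ {i : ℕ} (hi : i ≤ F.rank) :
    F.valency (i + 1) * qInt F.fieldOrder (i + 1) =
      F.valency i * (F.fieldOrder ^ i * F.thickness * qInt F.fieldOrder (F.rank - i)) := by
  have hq := F.fieldOrder_gt
  have hq0 : 0 < F.fieldOrder := by linarith
  have h1 := qBinom_succ_mul hq F.rank i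
  have e1 : F.fieldOrder ^ F.rank = F.fieldOrder ^ (F.rank - i) * F.fieldOrder ^ i := by
    rw [← pow_add, Nat.sub_add_cancel hi]
  have e2 : F.fieldOrder ^ (((i + 1 + 1).choose 2 : ℝ) + ((i + 1 : ℕ) : ℝ) * F.parameter) =
      F.fieldOrder ^ (((i + 1).choose 2 : ℝ) + i * F.parameter) *
        (F.fieldOrder ^ i * F.thickness) := by
    rw [thickness, ← Real.rpow_natCast, ← Real.rpow_add hq0, ← Real.rpow_add hq0]
    congr 1
    rw [Nat.choose_succ_succ' (i + 1) 1, Nat.choose_one_right]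
    push_cast
    ring
  rw [e1] at h1
  rw [valency, valency, e2, qInt, qInt]
  have h3 : F.fieldOrder - 1 ≠ 0 := by linarith
  have h4 : F.fieldOrder ^ i ≠ 0 := by positivity
  field_simp
  refine mul_left_cancel₀ h4 ?_
  linear_combination F.thickness * h1

theorem valency_nonneg (i : ℕ) : 0 ≤ F.valency i := by
  have hq := F.fieldOrder_gt
  refine mul_nonneg (Real.rpow_nonneg (by linarith) _) ?_
  rcases le_or_gt i F.rank with h | h
  · exact (qBinom_pos hq h).le
  · exact (qBinom_eq_zero_of_lt h).ge

theorem pNumber_eq (i k : ℕ) : F.pNumber i k =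
    F.valency i * (qBinom F.fieldOrder F.rank k)⁻¹ *
      uNumber F.fieldOrder F.thickness F.rank k i := by
  have hq := F.fieldOrder_gt
  have hq0 : 0 < F.fieldOrder := by linarith
  rw [pNumber, uNumber]
  congr 1
  have hsub : range (min i k + 1) ⊆ range (k + 1) :=
    range_subset_range.2 (by omega)
  -- The extra terms have `l > i`, where `binom(i, l) = 0`.
  rw [← sum_subset hsub]
  · refine sum_congr rfl fun l _ => ?_
    rw [mul_assoc _ (F.fieldOrder ^ (l * l) / F.fieldOrder ^ (l * i))]
    congr 1
    rw [thickness, ← Real.rpow_natCast (F.fieldOrder ^ (F.parameter + 1)) l, ← Real.rpow_mul hq0.le,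
      ← Real.rpow_neg hq0.le, ← Real.rpow_natCast, ← Real.rpow_natCast, ← Real.rpow_sub hq0,
      ← Real.rpow_add hq0]
    congr 1
    push_cast
    ring
  · intro l _ hl
    rw [mem_range] at *
    rw [qBinom_eq_zero_of_lt (m := i) (k := l) (by omega)]
    ring

theorem pNumber_zero {k : ℕ} (hk : k ≤ F.rank) : F.pNumber 0 k = 1 := by
  have := (qBinom_pos F.fieldOrder_gt hk).ne'
  rw [pNumber_eq, valency_zero, uNumber_zero, one_mul, inv_mul_cancel₀ this]

theorem pNumber_recursion {i k : ℕ} (hi : i ≤ F.rank) (hk : k ≤ F.rank) :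
    eigen F.fieldOrder F.thickness F.rank k * F.pNumber i k =
      qInt F.fieldOrder (i + 1) * F.pNumber (i + 1) k +
      qInt F.fieldOrder i * (F.thickness - 1) * F.pNumber i k +
      (if i = 0 then 0 else F.fieldOrder ^ (i - 1) * F.thickness *
        qInt F.fieldOrder (F.rank - (i - 1)) * F.pNumber (i - 1) k) := by
  have h := threeTerm_uNumber F.fieldOrder_gt F.thickness_pos hi hk
  have h1 := F.valency_succ hi
  rw [threeTerm] at h
  simp only [pNumber_eq]
  set b := (qBinom F.fieldOrder F.rank k)⁻¹
  rcases i with _ | i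
  · rw [if_pos rfl]
    rw [qInt_zero] at h ⊢
    linear_combination -F.valency 0 * b * h -
      b * uNumber F.fieldOrder F.thickness F.rank k (0 + 1) * h1
  · rw [if_neg (Nat.succ_ne_zero i)]
    have h2 := F.valency_succ (show i ≤ F.rank by omega)
    rw [Nat.add_sub_cancel] at h ⊢
    linear_combination -F.valency (i + 1) * b * h -
      b * uNumber F.fieldOrder F.thickness F.rank k (i + 1 + 1) * h1 +
      b * uNumber F.fieldOrder F.thickness F.rank k i * h2

/-- By `pNumber_eq` this is a weighted sum of squares with nonnegative weights, and the term `i = 0`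
is `binom(n, k) > 0`. -/
theorem eigenNorm_pos {k : ℕ} (hk : k ≤ F.rank) : 0 < F.eigenNorm k := by
  have hb := qBinom_pos F.fieldOrder_gt hk
  refine sum_pos' (fun i _ => ?_) ⟨0, mem_univ _, ?_⟩
  · rw [pNumber_eq]
    have := F.valency_nonneg i
    have h2 := mul_nonneg (mul_nonneg this (inv_nonneg.2 hb.le))
      (sq_nonneg (uNumber F.fieldOrder F.thickness F.rank k i))
    linarith
  · change 0 < uNumber F.fieldOrder F.thickness F.rank k 0 * F.pNumber 0 k
    rw [pNumber_zero F hk, uNumber_zero, mul_one]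
    exact hb

theorem eigenNorm_ne_zero {k : ℕ} (hk : k ≤ F.rank) : (F.eigenNorm k : ℂ) ≠ 0 := by
  exact_mod_cast (F.eigenNorm_pos hk).ne'

variable [FiniteDimensional K V]

theorem adjacency_one_mul_kernel (f : ℕ → ℝ) : F.adjacency 1 * F.kernel f =
    F.kernel (threeTerm F.fieldOrder F.thickness F.rank f) := by
  ext U W
  simp only [Matrix.mul_apply, adjacency, kernel, Matrix.of_apply, rel_iff, ite_mul, one_mul,
    zero_mul]
  rw [← sum_filter, dist_comm U W, ← sum_neighbors U W f]
  push_cast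
  exact sum_congr rfl fun Z _ => by rw [dist_comm]

theorem adjacency_one_mul_eigenKernel {k : ℕ} (hk : k ≤ F.rank) :
    F.adjacency 1 * F.eigenKernel k =
      (eigen F.fieldOrder F.thickness F.rank k : ℂ) • F.eigenKernel k := by
  rw [eigenKernel, adjacency_one_mul_kernel, ← kernel_smul]
  exact F.kernel_congr fun i hi => threeTerm_uNumber F.fieldOrder_gt F.thickness_pos hi hk

theorem adjacency_one_mul_adjacency (i : ℕ) :
    F.adjacency 1 * F.adjacency i =
      (qInt F.fieldOrder (i + 1) : ℂ) • F.adjacency (i + 1) +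
      ((qInt F.fieldOrder i * (F.thickness - 1) : ℝ) : ℂ) • F.adjacency i +
      (if i = 0 then 0 else ((F.fieldOrder ^ (i - 1) * F.thickness *
        qInt F.fieldOrder (F.rank - (i - 1)) : ℝ) : ℂ) • F.adjacency (i - 1)) := by
  rw [adjacency_eq F i, adjacency_one_mul_kernel]
  simp only [adjacency_eq]
  ext U W
  rcases i with _ | i
  · simp only [if_true, kernel, Matrix.add_apply, Matrix.of_apply, Matrix.smul_apply, smul_eq_mul,
      threeTerm, Matrix.zero_apply]
    generalize F.dist U W = d
    rcases d with _ | d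
    · simp [qInt_zero]
    · rcases d with _ | d <;> simp
  · simp only [if_neg (Nat.succ_ne_zero i), kernel, Matrix.add_apply, Matrix.of_apply,
      Matrix.smul_apply, smul_eq_mul, threeTerm, Nat.add_sub_cancel]
    generalize F.dist U W = d
    rcases d with _ | d
    · rcases i with _ | i <;> simp [qInt_zero]
    · rw [Nat.add_sub_cancel]
      by_cases h1 : d = i + 1
      · subst h1
        have hne : ¬ i + 1 + 1 = i := by omega
        simp only [if_neg hne]
        simp [hne]
      · by_cases h2 : d = i
        · subst h2
          simp
        · by_cases h3 : d + 1 = i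
          · subst h3
            simp [h1]
          · simp [h1, h2, h3]

/-- Since `[i+1] ≠ 0`, the expansion of `D_1 D_i` determines `D_{i+1}` from `D_i` and `D_{i-1}`, and
`pNumber_recursion` is the same relation for the scalars. -/
theorem adjacency_mul_eigenKernel {i k : ℕ} (hi : i ≤ F.rank) (hk : k ≤ F.rank) :
    F.adjacency i * F.eigenKernel k = (F.pNumber i k : ℂ) • F.eigenKernel k := by
  induction i using Nat.strong_induction_on with
  | _ i ih =>
  rcases i with _ | i
  · rw [adjacency_zero, pNumber_zero F hk]
    simp
  · have hA := ih i (Nat.lt_succ_self i) (by omega)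
    have h1 := congrArg (F.adjacency 1 * ·) hA
    simp only [Matrix.mul_smul, adjacency_one_mul_eigenKernel F hk] at h1
    rw [← Matrix.mul_assoc, adjacency_one_mul_adjacency, Matrix.add_mul, Matrix.add_mul,
      Matrix.smul_mul, Matrix.smul_mul, hA] at h1
    have h2 := F.pNumber_recursion (show i ≤ F.rank by omega) hk
    have h3 : (qInt F.fieldOrder (i + 1) : ℂ) ≠ 0 := by
      exact_mod_cast qInt_ne_zero F.fieldOrder_gt (Nat.succ_ne_zero i)
    have h2' := congrArg (fun r : ℝ => (r : ℂ) • F.eigenKernel k) h2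
    refine smul_right_injective _ h3 ?_
    rcases i with _ | i
    · simp only [if_true, Matrix.zero_mul, add_zero] at h1 h2'
      push_cast at h2' h1
      simp only [smul_smul] at h1 ⊢
      rw [add_smul] at h2'
      rw [mul_comm (F.pNumber 0 k : ℂ), h2'] at h1
      exact add_right_cancel h1
    · rw [if_neg (Nat.succ_ne_zero i), Nat.add_sub_cancel] at h1 h2
      simp only [if_neg (Nat.succ_ne_zero i), Nat.add_sub_cancel] at h2'
      rw [Matrix.smul_mul, ih i (by omega) (by omega)] at h1
      push_cast at h2' h1
      simp only [smul_smul] at h1 ⊢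
      rw [add_smul, add_smul] at h2'
      rw [mul_comm (F.pNumber (i + 1) k : ℂ), h2'] at h1
      exact add_right_cancel (add_right_cancel h1)

theorem kernel_mul_eigenKernel (f : ℕ → ℝ) {k : ℕ} (hk : k ≤ F.rank) :
    F.kernel f * F.eigenKernel k =
      ((∑ i : Fin (F.rank + 1), f i * F.pNumber i k : ℝ) : ℂ) • F.eigenKernel k := by
  rw [kernel_eq_sum, Finset.sum_mul]
  push_cast
  rw [Finset.sum_smul]
  refine sum_congr rfl fun i _ => ?_
  rw [Matrix.smul_mul, adjacency_mul_eigenKernel F (Nat.lt_succ_iff.1 i.2) hk, smul_smul]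

theorem eigenKernel_ne_zero {k : ℕ} (hk : k ≤ F.rank) : F.eigenKernel k ≠ 0 := by
  obtain ⟨U⟩ := F.nonempty_generator
  intro h
  have h1 := congrFun (congrFun h U) U
  rw [eigenKernel, kernel, Matrix.of_apply, dist_eq_zero.2 rfl, uNumber_zero,
    Matrix.zero_apply] at h1
  exact (qBinom_pos F.fieldOrder_gt hk).ne' (by exact_mod_cast h1)

/-- The product is a multiple of the second factor, so left multiplication by `D_1` scales it by
both eigenvalues, and these differ. -/
theorem eigenKernel_mul_of_ne {k l : ℕ} (hk : k ≤ F.rank) (hl : l ≤ F.rank) (hkl : k ≠ l) :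
    F.eigenKernel k * F.eigenKernel l = 0 := by
  have h1 := F.kernel_mul_eigenKernel (uNumber F.fieldOrder F.thickness F.rank k) hl
  rw [← eigenKernel] at h1
  set c : ℂ := ((∑ i : Fin (F.rank + 1), uNumber F.fieldOrder F.thickness F.rank k i *
    F.pNumber i l : ℝ) : ℂ)
  have h2 : (eigen F.fieldOrder F.thickness F.rank k : ℂ) • (c • F.eigenKernel l) =
      (eigen F.fieldOrder F.thickness F.rank l : ℂ) • (c • F.eigenKernel l) := by
    conv_lhs => rw [← h1, ← Matrix.smul_mul, ← adjacency_one_mul_eigenKernel F hk, Matrix.mul_assoc,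
      h1, Matrix.mul_smul, adjacency_one_mul_eigenKernel F hl, smul_comm]
  rw [← sub_eq_zero, ← sub_smul, smul_eq_zero, sub_eq_zero] at h2
  rw [h1]
  refine h2.resolve_left fun h => ?_
  exact eigen_ne F.fieldOrder_gt F.thickness_pos hkl hk hl (by exact_mod_cast h)

theorem kernel_mul_idem (f : ℕ → ℝ) {k : ℕ} (hk : k ≤ F.rank) : F.kernel f * F.idem k =
    ((∑ i : Fin (F.rank + 1), f i * F.pNumber i k : ℝ) : ℂ) • F.idem k := by
  rw [idem_eq, Matrix.mul_smul, kernel_mul_eigenKernel F f hk, smul_comm]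

theorem adjacency_mul_idem {i k : ℕ} (hi : i ≤ F.rank) (hk : k ≤ F.rank) :
    F.adjacency i * F.idem k = (F.pNumber i k : ℂ) • F.idem k := by
  rw [idem_eq, Matrix.mul_smul, adjacency_mul_eigenKernel F hi hk, smul_comm]

theorem adjacency_one_mul_idem {k : ℕ} (hk : k ≤ F.rank) :
    F.adjacency 1 * F.idem k = (eigen F.fieldOrder F.thickness F.rank k : ℂ) • F.idem k := by
  rw [idem_eq, Matrix.mul_smul, adjacency_one_mul_eigenKernel F hk, smul_comm]

theorem idem_ne_zero {k : ℕ} (hk : k ≤ F.rank) : F.idem k ≠ 0 := by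
  rw [idem_eq]
  exact smul_ne_zero (inv_ne_zero (F.eigenNorm_ne_zero hk)) (F.eigenKernel_ne_zero hk)

theorem idem_mul_idem {k l : ℕ} (hk : k ≤ F.rank) (hl : l ≤ F.rank) :
    F.idem k * F.idem l = if k = l then F.idem l else 0 := by
  split_ifs with h
  · subst h
    have h := F.kernel_mul_eigenKernel (uNumber F.fieldOrder F.thickness F.rank k) hk
    rw [← eigenKernel, ← eigenNorm] at h
    rw [idem_eq, Matrix.smul_mul, Matrix.mul_smul, h,
      smul_smul ((F.eigenNorm k : ℂ)⁻¹) (F.eigenNorm k : ℂ),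
      inv_mul_cancel₀ (F.eigenNorm_ne_zero hk), one_smul]
  · rw [idem_eq, idem_eq, Matrix.smul_mul, Matrix.mul_smul, eigenKernel_mul_of_ne F hk hl h,
      smul_zero, smul_zero]

theorem idem_mul_sum (c : Fin (F.rank + 1) → ℂ) (k : Fin (F.rank + 1)) :
    F.idem k * ∑ l : Fin (F.rank + 1), c l • F.idem l = c k • F.idem k := by
  rw [Finset.mul_sum, sum_eq_single k]
  · rw [Matrix.mul_smul, idem_mul_idem F (Nat.lt_succ_iff.1 k.2) (Nat.lt_succ_iff.1 k.2),
      if_pos rfl]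
  · intro l _ hl
    rw [Matrix.mul_smul, idem_mul_idem F (Nat.lt_succ_iff.1 k.2) (Nat.lt_succ_iff.1 l.2), if_neg,
      smul_zero]
    exact fun h => hl (Fin.ext h.symm)
  · simp

theorem sum_mul_idem (c : Fin (F.rank + 1) → ℂ) (k : Fin (F.rank + 1)) :
    (∑ l : Fin (F.rank + 1), c l • F.idem l) * F.idem k = c k • F.idem k := by
  rw [Finset.sum_mul, sum_eq_single k]
  · rw [Matrix.smul_mul, idem_mul_idem F (Nat.lt_succ_iff.1 k.2) (Nat.lt_succ_iff.1 k.2),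
      if_pos rfl]
  · intro l _ hl
    rw [Matrix.smul_mul, idem_mul_idem F (Nat.lt_succ_iff.1 l.2) (Nat.lt_succ_iff.1 k.2), if_neg,
      smul_zero]
    exact fun h => hl (Fin.ext h)
  · simp

theorem linearIndependent_idem :
    LinearIndependent ℂ fun k : Fin (F.rank + 1) => F.idem k := by
  rw [Fintype.linearIndependent_iff]
  intro c hc k
  have h := F.idem_mul_sum c k
  rw [hc, Matrix.mul_zero, eq_comm, smul_eq_zero] at h
  exact h.resolve_right (F.idem_ne_zero (Nat.lt_succ_iff.1 k.2))

/-- Inclusion and dimension: `n + 1` independent elements inside a span of `n + 1` matrices. -/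
theorem span_idem :
    Submodule.span ℂ (Set.range fun k : Fin (F.rank + 1) => F.idem k) = F.boseMesner := by
  refine Submodule.eq_of_le_of_finrank_le ?_ ?_
  · rw [Submodule.span_le]
    rintro _ ⟨k, rfl⟩
    change F.idem k ∈ F.boseMesner
    rw [idem, kernel_eq_sum]
    exact Submodule.sum_mem _ fun i _ => Submodule.smul_mem _ _ (Submodule.subset_span ⟨i, rfl⟩)
  · rw [finrank_span_eq_card F.linearIndependent_idem]
    exact finrank_range_le_card _

theorem adjacency_eq_sum_idem (i : Fin (F.rank + 1)) :
    F.adjacency i = ∑ k : Fin (F.rank + 1), (F.pNumber i k : ℂ) • F.idem k := by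
  have h : F.adjacency i ∈ F.boseMesner := Submodule.subset_span ⟨i, rfl⟩
  rw [← span_idem, Submodule.mem_span_range_iff_exists_fun] at h
  obtain ⟨c, hc⟩ := h
  rw [← hc]
  refine sum_congr rfl fun k _ => ?_
  rw [← F.sum_mul_idem c k, hc,
    adjacency_mul_idem F (Nat.lt_succ_iff.1 i.2) (Nat.lt_succ_iff.1 k.2)]

theorem isStandardIdempotents_idem :
    F.IsStandardIdempotents fun k : Fin (F.rank + 1) => F.idem k where
  linearIndependent := F.linearIndependent_idem
  span_eq := F.span_idem
  idempotent k := by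
    rw [idem_mul_idem F (Nat.lt_succ_iff.1 k.2) (Nat.lt_succ_iff.1 k.2), if_pos rfl]
  minimal k G hG hGG hkG := by
    rw [← span_idem, Submodule.mem_span_range_iff_exists_fun] at hG
    obtain ⟨c, rfl⟩ := hG
    rw [idem_mul_sum] at hkG
    rw [← hkG] at hGG ⊢
    rw [Matrix.smul_mul, Matrix.mul_smul,
      idem_mul_idem F (Nat.lt_succ_iff.1 k.2) (Nat.lt_succ_iff.1 k.2), if_pos rfl] at hGG
    by_cases hc : c k = 0
    · left; rw [hc, zero_smul]
    · right
      exact smul_right_injective _ hc hGG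
  ordering := F.adjacency_eq_sum_idem

/-- The ordering condition alone determines the `E_k`: the coefficients `idemCoeff` invert the
matrix of `P`-numbers. -/
theorem IsStandardIdempotents.eq_idem {F : ClassicalForm K V}
    {E : Fin (F.rank + 1) → Matrix F.Generator F.Generator ℂ} (hE : F.IsStandardIdempotents E)
    (l : Fin (F.rank + 1)) : E l = F.idem l := by
  have h : ∀ k : Fin (F.rank + 1),
      ∑ i : Fin (F.rank + 1), F.idemCoeff l i * F.pNumber i k = if l = k then 1 else 0 := by
    intro k
    have h1 := F.kernel_mul_idem (F.idemCoeff l) (Nat.lt_succ_iff.1 k.2)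
    rw [← idem, idem_mul_idem F (Nat.lt_succ_iff.1 l.2) (Nat.lt_succ_iff.1 k.2)] at h1
    have h2 := F.idem_ne_zero (Nat.lt_succ_iff.1 k.2)
    by_cases hlk : l = k
    · rw [if_pos hlk]
      rw [if_pos (congrArg Fin.val hlk)] at h1
      have h3 := smul_left_injective ℂ h2 (h1.symm.trans (one_smul ℂ _).symm)
      exact_mod_cast h3
    · rw [if_neg hlk]
      rw [if_neg fun h => hlk (Fin.ext h), eq_comm, smul_eq_zero] at h1
      exact_mod_cast h1.resolve_right h2
  rw [idem, kernel_eq_sum]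
  simp only [hE.ordering, Finset.smul_sum, smul_smul]
  rw [sum_comm]
  simp only [← Finset.sum_smul, ← Complex.ofReal_mul, ← Complex.ofReal_sum, h]
  simp

theorem exists_isQNumbers : ∃ Q, F.IsQNumbers Q := by
  refine ⟨fun k i => Fintype.card F.Generator * F.idemCoeff k i, _, F.isStandardIdempotents_idem,
    fun k => ?_⟩
  have hX : (Fintype.card F.Generator : ℂ) ≠ 0 := by
    have := F.nonempty_generator
    exact_mod_cast Fintype.card_ne_zero
  rw [idem, kernel_eq_sum, Finset.smul_sum]
  refine sum_congr rfl fun i _ => ?_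
  push_cast
  rw [smul_smul, ← mul_assoc, inv_mul_cancel₀ hX, one_mul]

end ClassicalForm

/-! ### Regularity of Steiner systems -/

namespace ClassicalForm

variable {K V : Type*} [Field K] [AddCommGroup V] [Module K V]

section Pairs

variable {F : ClassicalForm K V}

/-- The sum of the entries of a matrix over the pairs in `Y`. -/
noncomputable def quadSum (Y : Finset F.Generator) :
    Matrix F.Generator F.Generator ℂ →ₗ[ℂ] ℂ where
  toFun M := ∑ U ∈ Y, ∑ W ∈ Y, M U W
  map_add' M N := by simp [sum_add_distrib]
  map_smul' c M := by simp [mul_sum]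

theorem quadSum_eq_sum_columns (Y : Finset F.Generator) (M : Matrix F.Generator F.Generator ℂ) :
    quadSum Y M = ∑ W ∈ Y, ∑ U ∈ Y, M U W := sum_comm

theorem quadSum_adjacency (Y : Finset F.Generator) (i : ℕ) :
    quadSum Y (F.adjacency i) = ((#{z ∈ Y ×ˢ Y | F.Rel i z.1 z.2} : ℝ) : ℂ) := by
  have h : quadSum Y (F.adjacency i) = ∑ U ∈ Y, ∑ W ∈ Y, if F.Rel i U W then (1 : ℂ) else 0 := rfl
  rw [h, ← sum_product', sum_boole]
  simp

variable [FiniteDimensional K V]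

theorem innerDistribution_zero {Y : Finset F.Generator} (hY : Y.Nonempty) :
    F.innerDistribution Y 0 = 1 := by
  have hY0 : (#Y : ℝ) ≠ 0 := by exact_mod_cast (card_pos.2 hY).ne'
  have e : ({z ∈ Y ×ˢ Y | F.Rel 0 z.1 z.2} : Finset _) = Y.map ⟨fun U => (U, U), fun _ _ h => by
      simpa using h⟩ := by
    ext ⟨U, W⟩
    simp only [mem_filter, mem_product, rel_iff, dist_eq_zero, mem_map]
    constructor
    · rintro ⟨⟨h, -⟩, rfl⟩
      exact ⟨U, h, rfl⟩
    · rintro ⟨Z, h, hZ⟩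
      obtain ⟨rfl, rfl⟩ := Prod.mk.inj hZ
      exact ⟨⟨h, h⟩, rfl⟩
  rw [innerDistribution, e, card_map, div_self hY0]

end Pairs

variable [Finite K]

theorem one_add_rpow_eq (F : ClassicalForm K V) {l : ℕ} (hl : l < F.rank) :
    1 + F.fieldOrder ^ ((F.rank : ℝ) - (l : ℝ) + F.parameter) =
      1 + F.fieldOrder ^ (F.rank - 1 - l) * F.thickness := by
  have hq0 : 0 < F.fieldOrder := by linarith [F.fieldOrder_gt]
  rw [thickness, ← Real.rpow_natCast, ← Real.rpow_add hq0, Nat.cast_sub (by omega),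
    Nat.cast_sub (by omega)]
  congr 2
  push_cast
  ring

variable [FiniteDimensional K V] {F : ClassicalForm K V}

theorem sum_qBinom_steiner {t : ℕ} {Y : Finset F.Generator} (hY : F.IsSteinerSystem t Y)
    (htn : t ≤ F.rank) {j : ℕ} (hj : j ≤ t) (U : F.Generator) :
    ∑ Z ∈ Y, qBinom F.fieldOrder (F.rank - F.dist U Z) j =
      qBinom F.fieldOrder F.rank j *
        ∏ l ∈ Ico j t, (1 + F.fieldOrder ^ (F.rank - 1 - l) * F.thickness) := by
  have h := card_subspaces_between (bot_le : ⊥ ≤ U.1) (j := j) (by simp)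
  rw [finrank_bot, Nat.sub_zero, Nat.sub_zero, U.2.2] at h
  simp only [bot_le, true_and] at h
  change _ = qBinom F.fieldOrder _ _ at h
  rw [← h, ← nsmul_eq_mul, ← sum_const]
  simp only [← card_subspaces_inf,
    ← filter_filter (fun T : Submodule K V => T ≤ U.1 ∧ finrank K T = j)]
  rw [sum_card_filter_comm Y _ fun (Z : F.Generator) (T : Submodule K V) => T ≤ Z.1]
  refine sum_congr rfl fun T hT => ?_
  simp only [mem_filter, mem_univ, true_and] at hT
  rw [card_through F (U.2.1.mono hT.1) hY htn (hT.2.trans_le hj), hT.2]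

/-- Treating `X` as the case `t = n` lets the formula for `Y` apply to `X` too. -/
theorem isSteinerSystem_univ (F : ClassicalForm K V) : F.IsSteinerSystem F.rank univ :=
  fun T hT h => ⟨⟨T, hT, h⟩, ⟨mem_univ _, le_rfl⟩, fun _ hU => (eq_of_le hU.2).symm⟩

/-- The products for `Y` and `X` differ by the factors with `t ≤ l < n`, whatever `j` and `U` are.
The content is that one constant serves all of them. -/
theorem exists_sum_qBinom_proportional {t : ℕ} {Y : Finset F.Generator}
    (hY : F.IsSteinerSystem t Y) (htn : t ≤ F.rank) :
    ∃ c : ℝ, ∀ j ≤ t, ∀ U : F.Generator,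
      ∑ Z ∈ Y, qBinom F.fieldOrder (F.rank - F.dist U Z) j =
        c * ∑ Z, qBinom F.fieldOrder (F.rank - F.dist U Z) j := by
  refine ⟨(∏ l ∈ Ico t F.rank, (1 + F.fieldOrder ^ (F.rank - 1 - l) * F.thickness))⁻¹,
    fun j hj U => ?_⟩
  have hP : ∏ l ∈ Ico t F.rank, (1 + F.fieldOrder ^ (F.rank - 1 - l) * F.thickness) ≠ 0 := by
    refine (prod_pos fun l _ => ?_).ne'
    have h1 := F.fieldOrder_gt
    have h2 := F.thickness_pos
    positivity
  rw [sum_qBinom_steiner hY htn hj, sum_qBinom_steiner F.isSteinerSystem_univ le_rfl (hj.trans htn),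
    ← prod_Ico_consecutive _ hj htn, mul_left_comm, mul_comm (∏ l ∈ Ico j t, _),
    inv_mul_cancel_left₀ hP]

theorem nonempty_of_isSteinerSystem {t : ℕ} {Y : Finset F.Generator} (hY : F.IsSteinerSystem t Y)
    (htn : t ≤ F.rank) : Y.Nonempty := by
  by_contra h
  rw [not_nonempty_iff_eq_empty] at h
  have h1 := card_through F F.isTotallyIsotropic_bot hY htn (by simp)
  rw [h, filter_empty, card_empty, Nat.cast_zero, eq_comm, prod_eq_zero_iff] at h1
  obtain ⟨l, -, h2⟩ := h1
  have h3 := F.fieldOrder_gt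
  have h4 := F.thickness_pos
  have : 0 < 1 + F.fieldOrder ^ (F.rank - 1 - l) * F.thickness := by positivity
  exact this.ne' h2

/-! ### The inner distribution -/

section InnerDistribution

theorem sum_qBinom_mul_innerDistribution {t : ℕ} {Y : Finset F.Generator}
    (hY : F.IsSteinerSystem t Y) (htn : t ≤ F.rank) {j : ℕ} (hj : j ≤ t) :
    ∑ m ∈ range (F.rank + 1), qBinom F.fieldOrder m j * F.innerDistribution Y (F.rank - m) =
      qBinom F.fieldOrder F.rank j *
        ∏ l ∈ Ico j t, (1 + F.fieldOrder ^ (F.rank - 1 - l) * F.thickness) := by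
  have hY0 : (#Y : ℝ) ≠ 0 := by
    exact_mod_cast (card_pos.2 (nonempty_of_isSteinerSystem hY htn)).ne'
  refine mul_left_cancel₀ hY0 ?_
  have h : ∑ U ∈ Y, ∑ Z ∈ Y, qBinom F.fieldOrder (F.rank - F.dist U Z) j =
      #Y * (qBinom F.fieldOrder F.rank j *
        ∏ l ∈ Ico j t, (1 + F.fieldOrder ^ (F.rank - 1 - l) * F.thickness)) := by
    rw [sum_congr rfl fun U _ => sum_qBinom_steiner hY htn hj U, sum_const, nsmul_eq_mul]
  rw [← h, ← sum_product',
    ← sum_fiberwise_of_maps_to (t := range (F.rank + 1))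
      (g := fun z : F.Generator × F.Generator => F.rank - F.dist z.1 z.2)
      (fun z _ => mem_range.2 (by omega)), mul_sum]
  refine sum_congr rfl fun m hm => ?_
  have hm := mem_range.1 hm
  have e : ({z ∈ Y ×ˢ Y | F.rank - F.dist z.1 z.2 = m} : Finset _) =
      {z ∈ Y ×ˢ Y | F.Rel (F.rank - m) z.1 z.2} := by
    refine filter_congr fun z _ => ?_
    rw [rel_iff]
    have := dist_le z.1 z.2
    omega
  rw [sum_congr (g := fun _ => qBinom F.fieldOrder m j) rfl
    fun z hz => by rw [(mem_filter.1 hz).2], sum_const, nsmul_eq_mul, e,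
    innerDistribution]
  field_simp

theorem innerDistribution_eq_zero {t : ℕ} {Y : Finset F.Generator} (hY : F.IsSteinerSystem t Y)
    {m : ℕ} (htm : t ≤ m) (hm : m < F.rank) : F.innerDistribution Y (F.rank - m) = 0 := by
  rw [innerDistribution, filter_false_of_mem, card_empty, Nat.cast_zero, zero_div]
  rintro ⟨U, W⟩ hUW hrel
  rw [mem_product] at hUW
  have hm' : finrank K (U.1 ⊓ W.1 : Submodule K V) = m := by
    rw [Rel] at hrel
    dsimp only at hrel
    omega
  have h := card_subspaces_between (bot_le : ⊥ ≤ U.1 ⊓ W.1) (j := t) (by simp)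
  rw [finrank_bot, Nat.sub_zero, Nat.sub_zero, hm'] at h
  have hpos := qBinom_pos (one_lt_card_field K) htm
  rw [← h, Nat.cast_pos, card_pos] at hpos
  obtain ⟨T, hT⟩ := hpos
  simp only [mem_filter, mem_univ, true_and, bot_le, le_inf_iff] at hT
  have hU := (hY T (U.2.1.mono hT.1.1) hT.2).unique ⟨hUW.1, hT.1.1⟩ ⟨hUW.2, hT.1.2⟩
  rw [Rel, hU, inf_idem, W.2.2] at hrel
  omega

theorem innerDistribution_eq_sum {t : ℕ} {Y : Finset F.Generator} (hY : F.IsSteinerSystem t Y)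
    (htn : t ≤ F.rank) {i : ℕ} (hi : i < F.rank) :
    F.innerDistribution Y (F.rank - i) =
      ∑ j ∈ Ico i t, (-1 : ℝ) ^ (j - i) * F.fieldOrder ^ ((j - i).choose 2) *
        qBinom F.fieldOrder j i * qBinom F.fieldOrder F.rank j *
        ((∏ l ∈ Ico j t, (1 + F.fieldOrder ^ (F.rank - 1 - l) * F.thickness)) - 1) := by
  rcases le_or_gt t i with hit | hit
  · rw [Ico_eq_empty (by omega), sum_empty, innerDistribution_eq_zero hY hit hi]
  have h : ∀ j ∈ Ico i t, qBinom F.fieldOrder F.rank j *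
      ((∏ l ∈ Ico j t, (1 + F.fieldOrder ^ (F.rank - 1 - l) * F.thickness)) - 1) =
      ∑ m ∈ range t, qBinom F.fieldOrder m j * F.innerDistribution Y (F.rank - m) := by
    intro j hj
    -- The diagonal term `m = n` contributes `binom(n, j)`, the source of the `- 1`; the terms `t ≤
    -- m < n` vanish, leaving a triangular system in the `m < t`.
    have h1 := sum_qBinom_mul_innerDistribution hY htn (mem_Ico.1 hj).2.le
    rw [sum_range_succ, Nat.sub_self,
      innerDistribution_zero (nonempty_of_isSteinerSystem hY htn), mul_one] at h1
    rw [mul_sub, ← h1, mul_one, add_sub_cancel_right]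
    refine (sum_subset (range_subset_range.2 htn) fun m hm hmt => ?_).symm
    rw [mem_range] at hm hmt
    rw [innerDistribution_eq_zero hY (by omega) hm, mul_zero]
  rw [sum_congr rfl (g := fun j => ∑ m ∈ range t, F.innerDistribution Y (F.rank - m) *
    ((-1 : ℝ) ^ (j - i) * F.fieldOrder ^ ((j - i).choose 2) * qBinom F.fieldOrder j i *
      qBinom F.fieldOrder m j)), sum_comm]
  · simp only [← mul_sum]
    rw [sum_congr rfl fun m hm => by
      rw [sum_qBinom_inversion F.fieldOrder_gt (mem_range.1 hm)]]
    simp [hit]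
  · intro j hj
    rw [mul_assoc _ (qBinom F.fieldOrder F.rank j), h j hj, mul_sum]
    exact sum_congr rfl fun m _ => by ring

end InnerDistribution

/-! ### The dual distribution -/

section DualDistribution

theorem kernel_mul_kernel_apply_sum {f : ℕ → ℝ} (M : Matrix F.Generator F.Generator ℂ)
    (Y : Finset F.Generator) (W : F.Generator) :
    ∑ U ∈ Y, (F.kernel f * M) U W = ∑ Z, ((∑ U ∈ Y, f (F.dist Z U) : ℝ) : ℂ) * M Z W := by
  simp only [Matrix.mul_apply, kernel, Matrix.of_apply]
  rw [sum_comm]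
  refine sum_congr rfl fun Z _ => ?_
  rw [← Finset.sum_mul]
  push_cast
  simp only [dist_comm _ Z]

/-- The graph is regular of valency `x [n]`, the eigenvalue for `k = 0`, which differs from the
eigenvalue on `E_k`. So `E_k` is orthogonal to the all-one vector. -/
theorem sum_column_idem_eq_zero {k : ℕ} (hk0 : k ≠ 0) (hk : k ≤ F.rank) (W : F.Generator) :
    ∑ U, F.idem k U W = 0 := by
  have h1 := F.adjacency_one_mul_idem hk
  have h2 : ∑ U, (F.adjacency 1 * F.idem k) U W =
      (eigen F.fieldOrder F.thickness F.rank 0 : ℂ) * ∑ U, F.idem k U W := by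
    rw [adjacency_eq, kernel_mul_kernel_apply_sum, mul_sum]
    refine sum_congr rfl fun Z _ => ?_
    have h := card_neighbors_of_le Z (bot_le : ⊥ ≤ Z.1)
    simp only [bot_le, and_true, finrank_bot, Nat.sub_zero] at h
    rw [sum_boole, h, eigen, qInt_zero, sub_zero, Nat.sub_zero]
  rw [h1] at h2
  simp only [Matrix.smul_apply, smul_eq_mul, ← mul_sum] at h2
  rw [← sub_eq_zero, ← sub_mul, mul_eq_zero, sub_eq_zero] at h2
  refine h2.resolve_left fun h => ?_
  exact eigen_ne F.fieldOrder_gt F.thickness_pos hk0 hk (Nat.zero_le _) (by exact_mod_cast h)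

/-- The eigenvalue on `E_k` of the matrix that counts `j`-spaces in intersections of generators. -/
noncomputable def intersectionEigen (F : ClassicalForm K V) (j k : ℕ) : ℝ :=
  ∑ i : Fin (F.rank + 1), qBinom F.fieldOrder (F.rank - i) j * F.pNumber i k

theorem kernel_qBinom_mul_idem (j : ℕ) {k : ℕ} (hk : k ≤ F.rank) :
    (F.kernel fun i => qBinom F.fieldOrder (F.rank - i) j) * F.idem k =
      (F.intersectionEigen j k : ℂ) • F.idem k :=
  F.kernel_mul_idem _ hk

/-- Multiply `D_1 C_{j+1} = θ_{j+1} C_{j+1} + [n-j] C_j` by `E_k` and compare scalars, where `θ`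
stands for `eigen`. -/
theorem intersectionEigen_recursion {j k : ℕ} (hj : j < F.rank) (hk : k ≤ F.rank) :
    (eigen F.fieldOrder F.thickness F.rank k - eigen F.fieldOrder F.thickness F.rank (j + 1)) *
      F.intersectionEigen (j + 1) k = qInt F.fieldOrder (F.rank - j) * F.intersectionEigen j k := by
  have h1 := congrArg (F.adjacency 1 * ·) (kernel_qBinom_mul_idem (F := F) (j + 1) hk)
  simp only [Matrix.mul_smul, adjacency_one_mul_idem F hk] at h1
  have h2 : F.kernel (threeTerm F.fieldOrder F.thickness F.rank
      fun i => qBinom F.fieldOrder (F.rank - i) (j + 1)) =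
      (eigen F.fieldOrder F.thickness F.rank (j + 1) : ℂ) •
        (F.kernel fun i => qBinom F.fieldOrder (F.rank - i) (j + 1)) +
      (qInt F.fieldOrder (F.rank - j) : ℂ) •
        (F.kernel fun i => qBinom F.fieldOrder (F.rank - i) j) := by
    rw [← kernel_smul, ← kernel_smul]
    ext U W
    simp only [kernel, Matrix.add_apply, Matrix.of_apply]
    rw [threeTerm_qBinom F.fieldOrder_gt (dist_le U W) (show j + 1 ≤ F.rank from hj), if_neg (Nat.succ_ne_zero j),
      Nat.add_sub_add_right, Nat.add_sub_cancel]
    push_cast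
    rfl
  rw [← Matrix.mul_assoc, adjacency_one_mul_kernel, h2, Matrix.add_mul, Matrix.smul_mul,
    Matrix.smul_mul, kernel_qBinom_mul_idem _ hk, kernel_qBinom_mul_idem _ hk, smul_smul, smul_smul,
    smul_smul, ← add_smul] at h1
  have h3 := smul_left_injective ℂ (F.idem_ne_zero hk) h1
  have h4 : eigen F.fieldOrder F.thickness F.rank (j + 1) * F.intersectionEigen (j + 1) k +
      qInt F.fieldOrder (F.rank - j) * F.intersectionEigen j k =
      F.intersectionEigen (j + 1) k * eigen F.fieldOrder F.thickness F.rank k := by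
    exact_mod_cast h3
  linear_combination -h4

/-- Descend from `C_n = 1`: a zero at `j` would propagate to `j + 1`, because the eigenvalues for
`k` and `j + 1` differ when `k ≤ j`. -/
theorem intersectionEigen_ne_zero {j k : ℕ} (hkj : k ≤ j) (hj : j ≤ F.rank) :
    F.intersectionEigen j k ≠ 0 := by
  have hk := hkj.trans hj
  induction hj using Nat.decreasingInduction with
  | self =>
    have h : (F.kernel fun i => qBinom F.fieldOrder (F.rank - i) F.rank) = 1 := by
      rw [← adjacency_zero, adjacency_eq]
      refine F.kernel_congr fun i hi => ?_
      split_ifs with h0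
      · rw [h0, Nat.sub_zero, qBinom_self F.fieldOrder_gt]
      · exact qBinom_eq_zero_of_lt (by omega)
    have h1 := kernel_qBinom_mul_idem (F := F) F.rank hk
    rw [h, Matrix.one_mul] at h1
    intro h0
    rw [h0, Complex.ofReal_zero, zero_smul] at h1
    exact F.idem_ne_zero hk h1
  | of_succ j hj ih =>
    intro h0
    have h1 := intersectionEigen_recursion hj hk
    rw [h0, mul_zero, mul_eq_zero] at h1
    refine h1.elim (fun h => ?_) (ih (by omega))
    exact eigen_ne F.fieldOrder_gt F.thickness_pos (by omega) hk hj (sub_eq_zero.1 h)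

theorem quadSum_idem_eq_zero {t : ℕ} {Y : Finset F.Generator} (hY : F.IsSteinerSystem t Y)
    (htn : t ≤ F.rank) {k : ℕ} (hk0 : k ≠ 0) (hkt : k ≤ t) : quadSum Y (F.idem k) = 0 := by
  have hk := hkt.trans htn
  obtain ⟨c, hc⟩ := exists_sum_qBinom_proportional hY htn
  have hΛ : (F.intersectionEigen k k : ℂ) ≠ 0 := by
    exact_mod_cast intersectionEigen_ne_zero le_rfl hk
  rw [quadSum_eq_sum_columns]
  refine sum_eq_zero fun W _ => ?_
  -- Evaluating `C_k E_k` summed over the rows in `Y'` in two ways. For `Y' = Y` the result is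
  -- proportional to that for `Y' = X`, which vanishes.
  have key : ∀ Y' : Finset F.Generator,
      (F.intersectionEigen k k : ℂ) * ∑ U ∈ Y', F.idem k U W =
        ∑ Z, ((∑ U ∈ Y', qBinom F.fieldOrder (F.rank - F.dist Z U) k : ℝ) : ℂ) * F.idem k Z W := by
    intro Y'
    rw [← kernel_mul_kernel_apply_sum (f := fun i => qBinom F.fieldOrder (F.rank - i) k),
      kernel_qBinom_mul_idem k hk, mul_sum]
    rfl
  have h1 := key Y
  simp only [hc k hkt, Complex.ofReal_mul, mul_assoc] at h1
  rw [← mul_sum, ← key univ, sum_column_idem_eq_zero hk0 hk, mul_zero, mul_zero, mul_eq_zero] at h1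
  exact h1.resolve_left hΛ

theorem dualDistribution_eq_zero {t : ℕ} {Y : Finset F.Generator} (hY : F.IsSteinerSystem t Y)
    (htn : t ≤ F.rank) {Q : Fin (F.rank + 1) → Fin (F.rank + 1) → ℝ} (hQ : F.IsQNumbers Q)
    (k : Fin (F.rank + 1)) (hk0 : 1 ≤ (k : ℕ)) (hkt : (k : ℕ) ≤ t) :
    F.dualDistribution Q Y k = 0 := by
  obtain ⟨E, hE, hQ⟩ := hQ
  have h1 := quadSum_idem_eq_zero hY htn (Nat.one_le_iff_ne_zero.1 hk0) hkt
  rw [← hE.eq_idem k, hQ k] at h1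
  have hX : (Fintype.card F.Generator : ℂ) ≠ 0 := by
    have := F.nonempty_generator
    exact_mod_cast Fintype.card_ne_zero
  rw [map_smul, map_sum, smul_eq_mul, mul_eq_zero] at h1
  have h3 := h1.resolve_left (inv_ne_zero hX)
  simp only [map_smul, smul_eq_mul, quadSum_adjacency] at h3
  have h5 : ∑ i : Fin (F.rank + 1), Q k i * (#{z ∈ Y ×ˢ Y | F.Rel i z.1 z.2} : ℝ) = 0 := by
    exact_mod_cast h3
  simp only [dualDistribution, innerDistribution, ← mul_div_assoc]
  rw [← sum_div, h5, zero_div]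

end DualDistribution

end ClassicalForm

theorem proposition4p1 {K V : Type*} [Field K] [Finite K] [AddCommGroup V] [Module K V]
    [FiniteDimensional K V] (F : ClassicalForm K V) (n t : ℕ) (hn : F.rank = n)
    (ht : 1 ≤ t) (htn : t ≤ n) (Y : Finset F.Generator) (hY : F.IsSteinerSystem t Y) :
    (∀ i < n, F.innerDistribution Y (n - i) =
      ∑ j ∈ Finset.Ico i t, (-1 : ℝ) ^ (j - i) * F.fieldOrder ^ ((j - i).choose 2) *
        qBinom F.fieldOrder j i * qBinom F.fieldOrder n j *
        ((∏ l ∈ Finset.Ico j t, (1 + F.fieldOrder ^ ((n : ℝ) - (l : ℝ) + F.parameter))) - 1)) ∧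
    (∃ Q, F.IsQNumbers Q) ∧
    (∀ Q, F.IsQNumbers Q → ∀ k : Fin (F.rank + 1), 1 ≤ (k : ℕ) → (k : ℕ) ≤ t →
      F.dualDistribution Q Y k = 0) := by
  subst hn
  refine ⟨fun i hi => ?_, F.exists_isQNumbers,
    fun Q hQ k hk0 hkt => ClassicalForm.dualDistribution_eq_zero hY htn hQ k hk0 hkt⟩
  rw [ClassicalForm.innerDistribution_eq_sum hY htn hi]
  refine sum_congr rfl fun j hj => ?_
  congr 2
  refine prod_congr rfl fun l hl => ?_
  rw [F.one_add_rpow_eq ((mem_Ico.1 hl).2.trans_le htn)]
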